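/- **Theorem 2.** Let $\alpha\in[0,1)$, $\theta>-\alpha$, let $J\ge 1$ and $m\ge 0$ be integers, and let $\nu$ be a non-atomic probability measure on a measurable space $\mathcal V$ with measurable diagonal. Let $P\sim\mathrm{PYP}(\alpha,\theta,\nu)$ be a Pitman–Yor process, i.e. a random measure with the law of $\sum_{j\ge1}P_j\delta_{Y_j}$, where $P_j=V_j\prod_{i<j}(1-V_i)$, the $V_i\sim\mathrm{Beta}(1-\alpha,\theta+i\alpha)$ are independent, and the $Y_j$ are i.i.d. with distribution $\nu$ and independent of the $V_i$. Conditionally on $P$, let $X_1,\dots,X_{m+1}$ be i.i.d. with distribution $P$. Let $h:\mathcal V\to\{1,\dots,J\}$ be a perfectly random hash function drawn independently of the sample: conditionally on $(X_1,\dots,X_{m+1})$, the hash values of distinct tokens (fixed ones, or measurable functions of the sample such as the $X_i$ themselves) are i.i.d. uniform on $\{1,\dots,J\}$. Put $$f_{X_{m+1}}=\sum_{i=1}^m \mathbf 1\{X_i=X_{m+1}\},\qquad C_{h(X_{m+1})}=\sum_{i=1}^m\mathbf 1\{h(X_i)=h(X_{m+1})\}.$$ Write $(a)_{(n)}=\prod_{i=0}^{n-1}(a+i)$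 and $\mathscr C(n,k;\alpha)=\frac1{k!}\sum_{i=0}^k\binom ki(-1)^i(-i\alpha)_{(n)}$, and let $$p_{\alpha,\theta}(n,k)=\frac{(\theta/\alpha)_{(k)}}{(\theta)_{(n)}}\,\mathscr C(n,k;\alpha),\qquad G_{K_n}(t;\alpha,\theta)=\sum_{k=0}^n t^k\,p_{\alpha,\theta}(n,k),$$ where for $\alpha=0$ the product $(\theta/\alpha)_{(k)}\mathscr C(n,k;\alpha)$ is read as its limit $\theta^k|s(n,k)|$ ($|s(n,k)|$ being the unsigned Stirling numbers of the first kind), and for $\theta=0$, $n\ge1$, the common factor $\theta$ of $(\theta/\alpha)_{(k)}$ and $(\theta)_{(n)}$ is cancelled. Then the number $K_{m+1}$ of distinct values among $X_1,\dots,X_{m+1}$ satisfies $\Pr[K_{m+1}=k]=p_{\alpha,\theta}(m+1,k)$ for all $k\ge0$, so that $G_{K_{m+1}}(\cdot;\alpha,\theta)$ is its probability generating function. Moreover, for every $c$ with $\Pr[C_{h(X_{m+1})}=c]>0$ and every integer $l\ge0$, $$\Pr\bigl[f_{X_{m+1}}=l\,\big|\,C_{h(X_{m+1})}=c\bigr]=\frac{\theta}{J}\binom{c}{l}\frac{(\theta+\alpha)_{(m-l)}}{(\theta)_{(m+1)}}(1-\alpha)_{(l)}\;\frac{\sum_{i=0}^{m-c}\binom{m-c}{i}(-1)^{m-c-i}\,G_{K_{m-l-i}}\!\left(\tfrac1J;\alpha,\theta+\alpha\right)}{\sum_{i=0}^{m-c}\binom{m-c}{i}(-1)^{m-c-i}\,G_{K_{m-i+1}}\!\left(\tfrac1J;\alpha,\theta\right)},$$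 where the denominator of the last fraction is nonzero, for $\theta=0$ the ratio $\theta/(\theta)_{(m+1)}$ is read as $1/(1)_{(m)}$, and for $l>c$ the right-hand side is $0$. -/

import Mathlib

open MeasureTheory ProbabilityTheory
open scoped ENNReal

noncomputable section

namespace PYPSketch

/-- The rising factorial `(a)_(n) = a (a + 1) ⋯ (a + n - 1)`. -/
def rising (a : ℝ) (n : ℕ) : ℝ := ∏ i ∈ Finset.range n, (a + i)

/-- The generalized factorial coefficient
`𝒞(n, k; α) = (1 / k!) ∑_{i ≤ k} C(k, i) (-1)^i (-i α)_(n)`. -/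
def genFactCoeff (n k : ℕ) (α : ℝ) : ℝ :=
  (k.factorial : ℝ)⁻¹ *
    ∑ i ∈ Finset.range (k + 1), (k.choose i : ℝ) * (-1) ^ i * rising (-(i * α)) n

/-- The distribution of the number `K_n` of distinct values in a sample of size `n`,
`Pr[K_n = k] = (θ/α)_(k) / (θ)_(n) * 𝒞(n, k; α)`. At the two boundary values of the parameters
where this expression reads `0 / 0` it is replaced by its limit:
for `α = 0`, `(θ/α)_(k) 𝒞(n, k; α)` becomes `θ ^ k |s(n, k)|`, with `|s(n, k)|` the unsigned
Stirling numbers of the first kind; for `θ = 0` (and `n ≥ 1`), the common factor `θ` of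
`(θ/α)_(k)` and `(θ)_(n)` is cancelled. -/
def distinctPMF (α θ : ℝ) (n k : ℕ) : ℝ :=
  if α = 0 then
    θ ^ k / rising θ n * (n.stirlingFirst k : ℝ)
  else if θ = 0 ∧ n ≠ 0 then
    α⁻¹ * rising 1 (k - 1) / rising 1 (n - 1) * genFactCoeff n k α
  else
    rising (θ / α) k / rising θ n * genFactCoeff n k α

/-- The probability generating function `G_{K_n}(t; α, θ) = ∑_k t^k Pr[K_n = k]`. -/
def distinctPGF (n : ℕ) (t α θ : ℝ) : ℝ :=
  ∑ k ∈ Finset.range (n + 1), t ^ k * distinctPMF α θ n k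

/-- The factor `θ / (θ)_(n + 1)`, whose common factor `θ` is cancelled when `θ = 0`. -/
def thetaFactor (θ : ℝ) (n : ℕ) : ℝ :=
  if θ = 0 then 1 / rising 1 n else θ / rising θ (n + 1)

section PitmanYor

variable {V : Type*} [MeasurableSpace V]

/-- The discrete measure `∑_j P_j δ_{Y_j}` with stick-breaking weights
`P_j = W_j ∏_{i < j} (1 - W_i)` (indices start at `0`). -/
def stickBreaking (p : (ℕ → ℝ) × (ℕ → V)) : Measure V :=
  Measure.sum fun j =>
    ENNReal.ofReal (p.1 j * ∏ i ∈ Finset.range j, (1 - p.1 i)) • Measure.dirac (p.2 j)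

theorem measurable_stickBreaking :
    Measurable (stickBreaking : (ℕ → ℝ) × (ℕ → V) → Measure V) := by
  refine Measure.measurable_of_measurable_coe _ fun s hs => ?_
  simp only [stickBreaking, Measure.sum_apply _ hs, Measure.smul_apply, smul_eq_mul]
  refine Measurable.tsum fun j => Measurable.mul ?_ ?_
  · fun_prop
  · exact (Measure.measurable_coe hs).comp (Measure.measurable_dirac.comp (by fun_prop))

/-- The law `PYP(α, θ, ν)` of the Pitman–Yor process on `V`: the law of the random measure
`∑_j P_j δ_{Y_j}`, where the sticks `W_0, W_1, …` are independent, `W_i` has the distribution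
`Beta(1 - α, θ + (i + 1) α)` (indices start at `0`), and, independently of the sticks,
`Y_0, Y_1, …` are i.i.d. with distribution `ν`. -/
def pypLaw (α θ : ℝ) (ν : Measure V) : Measure (Measure V) :=
  ((Measure.infinitePi fun i : ℕ => betaMeasure (1 - α) (θ + (i + 1) * α)).prod
    (Measure.infinitePi fun _ : ℕ => ν)).map stickBreaking

variable {Ω : Type*} [MeasurableSpace Ω]

/-- `X_1, …, X_n` is a random sample from the random measure `P`: conditionally on `P`, the `X_i`
are i.i.d. with distribution `P`. -/
def IsSampleFrom {n : ℕ} (μ : Measure Ω) (X : Fin n → Ω → V) (P : Ω → Measure V) : Prop :=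
  (∀ i, Measurable (X i)) ∧
  ∀ (B : Set (Measure V)) (A : Fin n → Set V), MeasurableSet B → (∀ i, MeasurableSet (A i)) →
    μ {ω | P ω ∈ B ∧ ∀ i, X i ω ∈ A i} = ∫⁻ ω in {ω | P ω ∈ B}, ∏ i, P ω (A i) ∂μ

/-- The random function `h : V → [J]` is a perfectly random hash function drawn independently of
the random element `X`: conditionally on `X`, the hash values of distinct tokens are i.i.d.
uniform on the `J` buckets. The tokens are allowed to be functions `z_i(X)` of `X`, such as
the observations themselves; constant functions `z_i` give fixed tokens. -/
def IsPerfectlyRandomHash {S : Type*} [MeasurableSpace S] {J : ℕ} (μ : Measure Ω) (X : Ω → S)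
    (h : Ω → V → Fin J) : Prop :=
  (∀ z : S → V, Measurable z → Measurable fun ω => h ω (z (X ω))) ∧
  ∀ (k : ℕ) (z : Fin k → S → V) (A : Set S), (∀ i, Measurable (z i)) → MeasurableSet A →
    (∀ s ∈ A, Function.Injective fun i => z i s) →
    ∀ j : Fin k → Fin J,
      μ {ω | X ω ∈ A ∧ ∀ i, h ω (z i (X ω)) = j i} = μ {ω | X ω ∈ A} * (J : ℝ≥0∞)⁻¹ ^ k

end PitmanYor

/-- The frequency `f_v = ∑_{i ≤ m} 1{x_i = v}` of the token `v` in the stream `x_1, …, x_m`. -/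
def freq {V : Type*} {m : ℕ} (x : Fin m → V) (v : V) : ℕ :=
  ∑ i, Set.indicator {x i} (fun _ => 1) v

/-- The hashed frequency `C_{h(v)} = ∑_{i ≤ m} 1{h(x_i) = h(v)}` of the bucket of `v`. -/
def bucketCount {V : Type*} {m J : ℕ} (h : V → Fin J) (x : Fin m → V) (v : V) : ℕ :=
  ∑ i, Set.indicator {h (x i)} (fun _ => 1) (h v)

end PYPSketch

end

/-! Everything follows from the law of the partition of the sample indices into classes of equal
values. The atoms of the process are almost surely distinct because `ν` charges no point, so a
partition with block sizes n_b has as probability the expectation of ∑ ∏_b P_{e(b)}^{n_b} over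
injective choices e of atoms (`distinctSum`). The stick sequence is self-similar: after a first
stick of law Beta(1 - α, θ + α) the remaining sticks have the law with parameter θ + α. At most one
block can use the first atom, which gives a recursion from θ to θ + α; the closed form `sizeEPPF`
satisfies the same one. By induction on the number of blocks, the difference d of the two sides
obeys d(θ) = a(θ) d(θ + α). It is bounded, and the product of the a(θ + rα) tends to 0 since the
harmonic series diverges, so d = 0 (`lintegral_distinctSum`, `measure_ker_sample_eq`).

Three algebraic facts about this partition law are then used. Summing it over partitions with k
blocks gives the law of the number of distinct values (`sum_eppf_of_numBlocks`). Restricting it to a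
subset of the indices gives the same law on the subset (`sum_eppf_comap`). Fixing the block of one
point and deleting that block leaves the law with parameter θ + α, up to an explicit factor
(`sum_eppf_of_block`).

Given the partition, the points of T share a bucket with probability J · J^(-k), where k is the
number of blocks that meet T. Averaging over partitions yields generating functions at 1/J: with
parameter θ for the bucket alone, and with θ + α once the block of the last observation is
prescribed. Both probabilities depend only on the size of T, so inclusion–exclusion
(`measureReal_card_eq`) produces the alternating sums. The conditional probability is the quotient
of the joint law by the marginal one. -/

namespace PYPSketch

/-! ### Rising factorials -/

section Rising

@[simp]
theorem rising_zero (a : ℝ) : rising a 0 = 1 := by simp [rising]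

theorem rising_succ (a : ℝ) (n : ℕ) : rising a (n + 1) = rising a n * (a + n) := by
  simp [rising, Finset.prod_range_succ]

@[simp]
theorem rising_one (a : ℝ) : rising a 1 = a := by simp [rising]

theorem rising_add (a : ℝ) (m n : ℕ) : rising a (m + n) = rising a m * rising (a + m) n := by
  simp [rising, Finset.prod_range_add, add_assoc]

theorem rising_succ_left (a : ℝ) (n : ℕ) : rising a (n + 1) = a * rising (a + 1) n := by
  rw [add_comm, rising_add]; simp

theorem rising_pos {a : ℝ} (ha : 0 < a) (n : ℕ) : 0 < rising a n :=
  Finset.prod_pos fun i _ => by positivity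

theorem rising_mono {a b : ℝ} (ha : 0 ≤ a) (hab : a ≤ b) (n : ℕ) : rising a n ≤ rising b n :=
  Finset.prod_le_prod (fun i _ => by positivity) fun i _ => by linarith

theorem Gamma_add_natCast {a : ℝ} (ha : 0 < a) (n : ℕ) :
    Real.Gamma (a + n) = rising a n * Real.Gamma a := by
  induction n with
  | zero => simp
  | succ n ih =>
    rw [Nat.cast_succ, ← add_assoc, Real.Gamma_add_one (by positivity), ih, rising_succ]
    ring

end Rising

/-! ### Moments of the beta distribution -/

section BetaMoments

theorem beta_add_natCast {p q : ℝ} (hp : 0 < p) (hq : 0 < q) (a b : ℕ) :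
    beta (p + a) (q + b) = rising p a * rising q b / rising (p + q) (a + b) * beta p q := by
  have h : p + a + (q + b) = p + q + ((a + b : ℕ) : ℝ) := by push_cast; ring
  rw [beta, beta, h, Gamma_add_natCast hp, Gamma_add_natCast hq, Gamma_add_natCast (by positivity)]
  have := (rising_pos (add_pos hp hq) (a + b)).ne'
  have := (Real.Gamma_pos_of_pos (add_pos hp hq)).ne'
  field_simp

/-- Multiplying the Beta(p, q) density by x^a (1 - x)^b gives a constant multiple of the Beta(p + a,
q + b) density, which integrates to 1. -/
theorem lintegral_betaMeasure_moment {p q : ℝ} (hp : 0 < p) (hq : 0 < q) (a b : ℕ) :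
    ∫⁻ x, ENNReal.ofReal x ^ a * ENNReal.ofReal (1 - x) ^ b ∂betaMeasure p q =
      ENNReal.ofReal (rising p a * rising q b / rising (p + q) (a + b)) := by
  have hpa : 0 < p + a := by positivity
  have hqb : 0 < q + b := by positivity
  have hm : Measurable (betaPDF p q) := (measurable_betaPDFReal p q).ennreal_ofReal
  rw [betaMeasure, lintegral_withDensity_eq_lintegral_mul _ hm (by fun_prop)]
  have key : ∀ x : ℝ, (betaPDF p q * fun x => ENNReal.ofReal x ^ a * ENNReal.ofReal (1 - x) ^ b) x =
      ENNReal.ofReal (rising p a * rising q b / rising (p + q) (a + b)) *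
        betaPDF (p + a) (q + b) x := by
    intro x
    by_cases hx : 0 < x ∧ x < 1
    · obtain ⟨h0, h1⟩ := hx
      have h1' : 0 < 1 - x := by linarith
      have hbp := beta_pos hp hq
      have hr1 := rising_pos hp a
      have hr2 := rising_pos hq b
      have hr3 := rising_pos (add_pos hp hq) (a + b)
      rw [Pi.mul_apply, betaPDF_of_pos_lt_one h0 h1, betaPDF_of_pos_lt_one h0 h1,
        ← ENNReal.ofReal_pow h0.le, ← ENNReal.ofReal_pow h1'.le,
        ← ENNReal.ofReal_mul (by positivity), ← ENNReal.ofReal_mul (by positivity),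
        ← ENNReal.ofReal_mul (by positivity), beta_add_natCast hp hq,
        show p + a - 1 = (p - 1) + a by ring, show q + b - 1 = (q - 1) + b by ring,
        Real.rpow_add_natCast h0.ne', Real.rpow_add_natCast h1'.ne']
      congr 1
      field_simp
    · simp [betaPDF_eq, hx]
  simp_rw [key]
  have hm' : Measurable (betaPDF (p + a) (q + b)) :=
    (measurable_betaPDFReal _ _).ennreal_ofReal
  rw [lintegral_const_mul _ hm', lintegral_betaPDF_eq_one hpa hqb, mul_one]

theorem ae_betaMeasure_mem_Ioo (p q : ℝ) : ∀ᵐ x ∂betaMeasure p q, 0 < x ∧ x < 1 := by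
  have hm : Measurable (betaPDF p q) := (measurable_betaPDFReal p q).ennreal_ofReal
  rw [betaMeasure, ae_withDensity_iff hm]
  refine Filter.Eventually.of_forall fun x hx => ?_
  by_contra h
  exact hx (by simp [betaPDF_eq, h])

end BetaMoments

/-! ### Splitting off the first coordinate of an infinite product measure -/

section HeadTail

/-- The sequence with first entry `x`, followed by the entries of `v`. -/
def consSeq {E : Type*} (x : E) (v : ℕ → E) : ℕ → E
  | 0 => x
  | n + 1 => v n

@[simp]
theorem consSeq_zero {E : Type*} (x : E) (v : ℕ → E) : consSeq x v 0 = x := rfl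

@[simp]
theorem consSeq_succ {E : Type*} (x : E) (v : ℕ → E) (n : ℕ) : consSeq x v (n + 1) = v n := rfl

theorem measurable_consSeq {E : Type*} [MeasurableSpace E] :
    Measurable fun p : E × (ℕ → E) => consSeq p.1 p.2 := by
  refine measurable_pi_lambda _ fun n => ?_
  cases n with
  | zero => exact measurable_fst
  | succ n => exact (measurable_pi_apply n).comp measurable_snd

theorem infinitePi_eq_map_consSeq {E : Type*} [MeasurableSpace E] (μ : ℕ → Measure E)
    [∀ i, IsProbabilityMeasure (μ i)] :
    Measure.infinitePi μ =
      ((μ 0).prod (Measure.infinitePi fun i => μ (i + 1))).map fun p => consSeq p.1 p.2 := by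
  classical
  refine (Measure.eq_infinitePi μ fun s t ht => ?_).symm
  set t' : ℕ → Set E := fun i => if i ∈ s then t i else Set.univ with ht'
  have hmt' : ∀ i, MeasurableSet (t' i) := fun i => by
    simp only [ht']; split_ifs <;> simp [ht]
  -- The cylinder is written over an initial segment, unconstrained coordinates being filled with
  -- the whole space, so that its preimage is a rectangle in head and tail.
  obtain ⟨N, hN⟩ : ∃ N, s ⊆ Finset.range (N + 1) :=
    ⟨s.sup id, fun i hi => by
      simpa [Nat.lt_succ_iff] using Finset.le_sup (f := id) hi⟩
  have hpre : (fun p : E × (ℕ → E) => consSeq p.1 p.2) ⁻¹' (Set.pi (s : Set ℕ) t) =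
      t' 0 ×ˢ Set.pi (Finset.range N : Set ℕ) fun i => t' (i + 1) := by
    ext ⟨x, v⟩
    simp only [Set.mem_preimage, Set.mem_pi, Set.mem_prod, Finset.mem_coe, ht']
    constructor
    · intro H
      refine ⟨?_, fun i _ => ?_⟩
      · split_ifs with h0
        · exact H 0 h0
        · trivial
      · split_ifs with h0
        · exact H (i + 1) h0
        · trivial
    · rintro ⟨H0, H1⟩ i hi
      cases i with
      | zero => simpa [hi] using H0
      | succ i =>
        have := H1 i (by simpa using hN hi)
        simpa [hi] using this
  rw [Measure.map_apply measurable_consSeq (MeasurableSet.pi s.countable_toSet fun i _ => ht i),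
    hpre, Measure.prod_prod, Measure.infinitePi_pi _ (fun i _ => hmt' _), mul_comm,
    ← Finset.prod_range_succ' (fun i => μ i (t' i)), ← Finset.prod_subset hN]
  · exact Finset.prod_congr rfl fun i hi => by simp [ht', hi]
  · intro i _ hi
    simp [ht', hi]

end HeadTail

/-! ### Self-similarity of the stick sequence -/

section Sticks

/-- The law of the sticks of the Pitman–Yor process. -/
noncomputable def stickLaw (α θ : ℝ) : Measure (ℕ → ℝ) :=
  Measure.infinitePi fun i : ℕ => betaMeasure (1 - α) (θ + (i + 1) * α)

variable {α θ : ℝ}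

theorem stick_param_pos (hα0 : 0 ≤ α) (hθ : -α < θ) (i : ℕ) : 0 < θ + (i + 1) * α := by
  nlinarith [mul_nonneg (Nat.cast_nonneg (α := ℝ) i) hα0]

theorem isProbabilityMeasure_stick (hα0 : 0 ≤ α) (hα1 : α < 1) (hθ : -α < θ) (i : ℕ) :
    IsProbabilityMeasure (betaMeasure (1 - α) (θ + (i + 1) * α)) :=
  isProbabilityMeasureBeta (by linarith) (stick_param_pos hα0 hθ i)

theorem isProbabilityMeasure_stickLaw (hα0 : 0 ≤ α) (hα1 : α < 1) (hθ : -α < θ) :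
    IsProbabilityMeasure (stickLaw α θ) := by
  have := isProbabilityMeasure_stick hα0 hα1 hθ
  unfold stickLaw; infer_instance

/-- The parameter θ + (i + 2)α of the stick with index i + 1 is (θ + α) + (i + 1)α; hence the tail
is again a stick sequence, with θ replaced by θ + α. -/
theorem stickLaw_eq_map (hα0 : 0 ≤ α) (hα1 : α < 1) (hθ : -α < θ) :
    stickLaw α θ = ((betaMeasure (1 - α) (θ + α)).prod (stickLaw α (θ + α))).map
      fun p => consSeq p.1 p.2 := by
  have := isProbabilityMeasure_stick hα0 hα1 hθ
  rw [stickLaw, infinitePi_eq_map_consSeq, stickLaw]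
  congr 3
  · simp
  · ext1 i
    congr 1
    push_cast
    ring

theorem ae_stickLaw_mem_Ioo (hα0 : 0 ≤ α) (hα1 : α < 1) (hθ : -α < θ) :
    ∀ᵐ v ∂stickLaw α θ, ∀ i, 0 < v i ∧ v i < 1 := by
  have := isProbabilityMeasure_stick hα0 hα1 hθ
  rw [ae_all_iff]
  intro i
  exact (measurePreserving_eval_infinitePi
    (fun i : ℕ => betaMeasure (1 - α) (θ + (i + 1) * α)) i).quasiMeasurePreserving.ae
      (ae_betaMeasure_mem_Ioo _ _)

end Sticks

/-! ### Sums over injective choices of atoms -/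

section DistinctSum

/-- `∑ ∏_b w (e b) ^ n b`, the sum being over the injective families `e` of indices. -/
noncomputable def distinctSum (w : ℕ → ℝ≥0∞) {k : ℕ} (n : Fin k → ℕ) : ℝ≥0∞ :=
  ∑' e : Fin k ↪ ℕ, ∏ b, w (e b) ^ n b

theorem insertNth_zero_injective {k : ℕ} (b : Fin (k + 1)) (e : Fin k ↪ ℕ) :
    Function.Injective (b.insertNth (α := fun _ => ℕ) 0 fun i => e i + 1) := by
  intro x y
  refine b.succAboveCases ?_ (fun i => ?_) x <;> refine b.succAboveCases ?_ (fun j => ?_) y <;>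
    simp

/-- The embedding that sends `b` to `0` and is otherwise given by the shift of `e`. -/
def insertZero {k : ℕ} (b : Fin (k + 1)) (e : Fin k ↪ ℕ) : Fin (k + 1) ↪ ℕ :=
  ⟨_, insertNth_zero_injective b e⟩

@[simp]
theorem insertZero_same {k : ℕ} (b : Fin (k + 1)) (e : Fin k ↪ ℕ) : insertZero b e b = 0 := by
  simp [insertZero]

@[simp]
theorem insertZero_succAbove {k : ℕ} (b : Fin (k + 1)) (e : Fin k ↪ ℕ) (i : Fin k) :
    insertZero b e (b.succAbove i) = e i + 1 := by
  simp [insertZero]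

/-- Embeddings into `ℕ`, according to the element which is sent to `0`. -/
noncomputable def embeddingSplit (k : ℕ) :
    (Fin (k + 1) ↪ ℕ) ⊕ (Σ _ : Fin (k + 1), Fin k ↪ ℕ) ≃ (Fin (k + 1) ↪ ℕ) :=
  Equiv.ofBijective
    (Sum.elim (fun e => e.trans ⟨Nat.succ, Nat.succ_injective⟩) fun p => insertZero p.1 p.2) <| by
    constructor
    · rintro (e | ⟨b, e⟩) (e' | ⟨b', e'⟩) H
      · congr 1
        ext i
        simpa using DFunLike.congr_fun H i
      · have := DFunLike.congr_fun H b'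
        simp at this
      · have := DFunLike.congr_fun H b
        simp at this
      · have hb : b = b' := by
          have h1 := DFunLike.congr_fun H b
          apply (insertZero b' e').injective
          simpa using h1.symm
        subst hb
        congr 2
        ext i
        simpa using DFunLike.congr_fun H (b.succAbove i)
    · intro e
      by_cases h : ∃ b, e b = 0
      · obtain ⟨b, hb⟩ := h
        have hne : ∀ i, e (b.succAbove i) ≠ 0 := fun i hi =>
          b.succAbove_ne i (e.injective (hi.trans hb.symm))
        refine ⟨Sum.inr ⟨b, ⟨fun i => e (b.succAbove i) - 1, ?_⟩⟩, ?_⟩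
        · intro i j hij
          have hi := hne i
          have hj := hne j
          exact b.succAbove_right_injective (e.injective (by dsimp only at hij; omega))
        · ext x
          refine b.succAboveCases ?_ (fun i => ?_) x
          · simp [hb]
          · rw [Sum.elim_inr, insertZero_succAbove]
            exact Nat.sub_add_cancel (Nat.pos_of_ne_zero (hne i))
      · push Not at h
        refine ⟨Sum.inl ⟨fun i => e i - 1, ?_⟩, ?_⟩
        · intro i j hij
          have hi := h i
          have hj := h j
          exact e.injective (by dsimp only at hij; omega)
        · ext x
          exact Nat.sub_add_cancel (Nat.pos_of_ne_zero (h x))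

theorem embeddingSplit_inl {k : ℕ} (e : Fin (k + 1) ↪ ℕ) (b : Fin (k + 1)) :
    embeddingSplit k (Sum.inl e) b = e b + 1 := rfl

theorem embeddingSplit_inr {k : ℕ} (b : Fin (k + 1)) (e : Fin k ↪ ℕ) :
    embeddingSplit k (Sum.inr ⟨b, e⟩) = insertZero b e := rfl

theorem distinctSum_zero (w : ℕ → ℝ≥0∞) (n : Fin 0 → ℕ) : distinctSum w n = 1 := by
  simp [distinctSum]

/-- An injective choice of indices either avoids index 0 or assigns it to exactly one block b; in
both cases the remaining indices form an injective choice shifted by one. -/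
theorem distinctSum_succ (a c : ℝ≥0∞) (w : ℕ → ℝ≥0∞) {k : ℕ} (n : Fin (k + 1) → ℕ) :
    distinctSum (consSeq a fun j => c * w j) n =
      c ^ (∑ b, n b) * distinctSum w n +
        ∑ b, a ^ n b * c ^ (∑ i, n (b.succAbove i)) * distinctSum w fun i => n (b.succAbove i) := by
  rw [distinctSum, ← (embeddingSplit k).tsum_eq,
    ENNReal.summable.tsum_sum ENNReal.summable, ENNReal.tsum_sigma',
    tsum_fintype (L := SummationFilter.unconditional (Fin (k + 1)))]
  congr 1
  · rw [distinctSum, ← ENNReal.tsum_mul_left]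
    refine tsum_congr fun e => ?_
    simp [embeddingSplit_inl, mul_pow, Finset.prod_mul_distrib, Finset.prod_pow_eq_pow_sum]
  · refine Finset.sum_congr rfl fun b _ => ?_
    rw [distinctSum, ← ENNReal.tsum_mul_left]
    refine tsum_congr fun e => ?_
    rw [Fin.prod_univ_succAbove _ b]
    simp [embeddingSplit_inr, mul_pow, Finset.prod_mul_distrib, Finset.prod_pow_eq_pow_sum,
      mul_assoc]

theorem measurable_distinctSum {Ω : Type*} [MeasurableSpace Ω] {w : Ω → ℕ → ℝ≥0∞}
    (hw : ∀ j, Measurable fun ω => w ω j) {k : ℕ} (n : Fin k → ℕ) :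
    Measurable fun ω => distinctSum (w ω) n := by
  have : Countable (Fin k ↪ ℕ) := DFunLike.coe_injective.countable
  exact Measurable.tsum fun e => Finset.measurable_fun_prod _ fun b _ => (hw _).pow_const _

theorem prod_tsum_eq_tsum_prod {k : ℕ} (f : Fin k → ℕ → ℝ≥0∞) :
    ∏ i, ∑' j, f i j = ∑' I : Fin k → ℕ, ∏ i, f i (I i) := by
  induction k with
  | zero => simp
  | succ k ih =>
    rw [Fin.prod_univ_succ, ih, ← (Fin.consEquiv fun _ => ℕ).tsum_eq, ENNReal.tsum_prod',
      ← ENNReal.tsum_mul_right]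
    refine tsum_congr fun j => ?_
    rw [← ENNReal.tsum_mul_left]
    refine tsum_congr fun I => ?_
    simp [Fin.prod_univ_succ]

/-- Dropping injectivity only enlarges the sum, which then factors over the blocks. Nonzero
exponents are needed for w^n ≤ w. -/
theorem distinctSum_le_one {w : ℕ → ℝ≥0∞} (hw : ∑' j, w j ≤ 1) {k : ℕ} (n : Fin k → ℕ)
    (hn : ∀ b, n b ≠ 0) : distinctSum w n ≤ 1 := by
  calc distinctSum w n ≤ ∑' I : Fin k → ℕ, ∏ b, w (I b) ^ n b :=
        ENNReal.tsum_comp_le_tsum_of_injective DFunLike.coe_injective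
          fun I : Fin k → ℕ => ∏ b, w (I b) ^ n b
    _ = ∏ b, ∑' j, w j ^ n b := (prod_tsum_eq_tsum_prod fun b j => w j ^ n b).symm
    _ ≤ ∏ b : Fin k, 1 := by
        refine Finset.prod_le_prod' fun b _ => le_trans (ENNReal.tsum_le_tsum fun j => ?_) hw
        exact pow_le_of_le_one zero_le ((ENNReal.le_tsum j).trans hw) (hn b)
    _ = 1 := by simp

end DistinctSum

/-! ### Stick-breaking weights -/

section StickWeights

/-- The stick-breaking weights, as extended nonnegative reals. -/
noncomputable def stickWeight (v : ℕ → ℝ) (j : ℕ) : ℝ≥0∞ :=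
  ENNReal.ofReal (v j) * ∏ i ∈ Finset.range j, ENNReal.ofReal (1 - v i)

theorem measurable_stickWeight (j : ℕ) : Measurable fun v => stickWeight v j := by
  unfold stickWeight; fun_prop

theorem ofReal_stick_eq_stickWeight {v : ℕ → ℝ} (hv : ∀ i, v i ≤ 1) (j : ℕ) :
    ENNReal.ofReal (v j * ∏ i ∈ Finset.range j, (1 - v i)) = stickWeight v j := by
  have h : ∀ i ∈ Finset.range j, 0 ≤ 1 - v i := fun i _ => sub_nonneg.2 (hv i)
  rw [ENNReal.ofReal_mul' (Finset.prod_nonneg h), ENNReal.ofReal_prod_of_nonneg h, stickWeight]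

theorem stickWeight_consSeq (x : ℝ) (v : ℕ → ℝ) :
    stickWeight (consSeq x v) =
      consSeq (ENNReal.ofReal x) fun j => ENNReal.ofReal (1 - x) * stickWeight v j := by
  ext j
  cases j with
  | zero => simp [stickWeight]
  | succ j => simp [stickWeight, Finset.prod_range_succ']; ring

/-- The first N weights and the unbroken remainder ∏ (1 - v_i) add up to 1. The upper bound
suffices: that the weights exhaust the stick is not needed here. -/
theorem tsum_stickWeight_le_one {v : ℕ → ℝ} (hv : ∀ i, 0 ≤ v i ∧ v i ≤ 1) :
    ∑' j, stickWeight v j ≤ 1 := by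
  refine ENNReal.tsum_le_of_sum_range_le fun N => ?_
  have h : ∑ j ∈ Finset.range N, stickWeight v j +
      ∏ i ∈ Finset.range N, ENNReal.ofReal (1 - v i) = 1 := by
    induction N with
    | zero => simp
    | succ N ih =>
      rw [← ih, Finset.sum_range_succ, Finset.prod_range_succ, add_assoc]
      congr 1
      rw [stickWeight, mul_comm (∏ i ∈ _, _) (ENNReal.ofReal (1 - v N)), ← add_mul,
        ← ENNReal.ofReal_add (hv N).1 (sub_nonneg.2 (hv N).2)]
      simp
  exact h ▸ le_self_add

end StickWeights

/-! ### The partition probability as a function of block sizes -/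

section BlockSizes

/-- The factor of the probability of a partition of `n` points into `k` blocks that does not depend
on the sizes of the blocks. -/
noncomputable def partitionWeight (α θ : ℝ) (n k : ℕ) : ℝ :=
  (∏ i ∈ Finset.range (k - 1), (θ + (i + 1) * α)) / rising (θ + 1) (n - 1)

/-- The exchangeable partition probability function of the Pitman–Yor process, as a function of the
sizes of the blocks. -/
noncomputable def sizeEPPF (α θ : ℝ) {k : ℕ} (n : Fin k → ℕ) : ℝ :=
  partitionWeight α θ (∑ b, n b) k * ∏ b, rising (1 - α) (n b - 1)

variable {α θ : ℝ}

theorem partitionWeight_nonneg (hα0 : 0 ≤ α) (hα1 : α < 1) (hθ : -α < θ) (n k : ℕ) :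
    0 ≤ partitionWeight α θ n k :=
  div_nonneg (Finset.prod_nonneg fun i _ => (stick_param_pos hα0 hθ i).le)
    (rising_pos (by linarith) _).le

/-- Passing from `θ` to `θ + α` amounts to the removal of a block. -/
theorem rising_mul_partitionWeight (hθ : -α < θ) {n k : ℕ}
    (h : n = 0 ↔ k = 0) :
    rising (θ + α) n * partitionWeight α (θ + α) n k =
      ∏ i ∈ Finset.range k, (θ + (i + 1) * α) := by
  rcases k with _ | k
  · simp [h.2 rfl, partitionWeight]
  · obtain ⟨n, rfl⟩ := Nat.exists_eq_succ_of_ne_zero (mt h.1 k.succ_ne_zero)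
    have := (rising_pos (show 0 < θ + α + 1 by linarith) n).ne'
    rw [partitionWeight, Nat.succ_eq_add_one, rising_succ_left, Finset.prod_range_succ']
    simp only [Nat.add_sub_cancel, CharP.cast_eq_zero, Nat.cast_add, Nat.cast_one]
    field_simp
    rw [zero_add, mul_one, mul_comm]
    congr 1
    exact Finset.prod_congr rfl fun i _ => by ring

/-- All terms on the right share the factor A Φ / (θ + 1)_(N). What remains is θ + (k + 1)α + ∑_b
(n_b - α) = θ + N, the last factor of (θ + 1)_(N). -/
theorem sizeEPPF_recursion (hα1 : α < 1) (hθ : -α < θ) {k : ℕ}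
    (n : Fin (k + 1) → ℕ) (hn : ∀ b, n b ≠ 0) :
    sizeEPPF α θ n =
      rising (θ + α) (∑ b, n b) / rising (θ + 1) (∑ b, n b) * sizeEPPF α (θ + α) n +
        ∑ b, rising (1 - α) (n b) * rising (θ + α) (∑ i, n (b.succAbove i)) /
          rising (θ + 1) (∑ b, n b) * sizeEPPF α (θ + α) fun i => n (b.succAbove i) := by
  set N := ∑ b, n b with hN
  have hN0 : N ≠ 0 := fun h => hn 0 (by
    rw [hN, Finset.sum_eq_zero_iff] at h
    exact h 0 (Finset.mem_univ _))
  obtain ⟨M, hM⟩ := Nat.exists_eq_succ_of_ne_zero hN0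
  set Φ := ∏ b, rising (1 - α) (n b - 1) with hΦ
  set A := ∏ i ∈ Finset.range k, (θ + (i + 1) * α) with hA
  have hr : 0 < rising (θ + 1) N := rising_pos (by linarith) _
  have h1 : rising (θ + α) N / rising (θ + 1) N * sizeEPPF α (θ + α) n =
      A * Φ / rising (θ + 1) N * (θ + (k + 1) * α) := by
    rw [sizeEPPF, ← hN, ← hΦ, div_mul_eq_mul_div, ← mul_assoc,
      rising_mul_partitionWeight hθ (by simp [hN0]), Finset.prod_range_succ]
    ring
  have h2 : ∀ b, rising (1 - α) (n b) * rising (θ + α) (∑ i, n (b.succAbove i)) /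
      rising (θ + 1) N * sizeEPPF α (θ + α) (fun i => n (b.succAbove i)) =
      A * Φ / rising (θ + 1) N * (n b - α) := by
    intro b
    have hb : rising (1 - α) (n b) = rising (1 - α) (n b - 1) * (n b - α) := by
      obtain ⟨j, hj⟩ := Nat.exists_eq_succ_of_ne_zero (hn b)
      rw [hj, Nat.succ_eq_add_one, rising_succ, Nat.add_sub_cancel]
      push_cast
      ring
    have hk : ∑ i, n (b.succAbove i) = 0 ↔ k = 0 := by
      constructor
      · intro h
        by_contra hk
        rw [Finset.sum_eq_zero_iff] at h
        exact hn _ (h ⟨0, Nat.pos_of_ne_zero hk⟩ (Finset.mem_univ _))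
      · rintro rfl
        simp
    have hA' := rising_mul_partitionWeight hθ hk
    rw [← hA] at hA'
    rw [sizeEPPF, hb, hΦ, Fin.prod_univ_succAbove _ b, ← hA']
    ring
  rw [h1, Finset.sum_congr rfl fun b _ => h2 b, ← Finset.mul_sum, ← mul_add,
    Finset.sum_sub_distrib, ← Nat.cast_sum, ← hN, sizeEPPF, ← hN, ← hΦ, partitionWeight]
  simp only [Nat.add_sub_cancel, Finset.sum_const, Finset.card_univ, Fintype.card_fin, nsmul_eq_mul]
  rw [← hA]
  have hr' : rising (θ + 1) N = rising (θ + 1) (N - 1) * (θ + N) := by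
    rw [hM, Nat.succ_eq_add_one, rising_succ, Nat.add_sub_cancel]
    push_cast
    ring
  rw [hr'] at hr ⊢
  have := left_ne_zero_of_mul hr.ne'
  have := right_ne_zero_of_mul hr.ne'
  field_simp
  push_cast
  ring

theorem sizeEPPF_nonneg (hα0 : 0 ≤ α) (hα1 : α < 1) (hθ : -α < θ) {k : ℕ} (n : Fin k → ℕ) :
    0 ≤ sizeEPPF α θ n :=
  mul_nonneg (partitionWeight_nonneg hα0 hα1 hθ _ _)
    (Finset.prod_nonneg fun b _ => (rising_pos (by linarith) _).le)

/-- `sizeEPPF` is bounded, uniformly in large values of `θ`. -/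
theorem exists_sizeEPPF_le (hα0 : 0 ≤ α) (hα1 : α < 1) (hθ : -α < θ) {k : ℕ}
    (n : Fin (k + 1) → ℕ) (hn : ∀ b, n b ≠ 0) :
    ∃ M, ∀ θ', θ ≤ θ' → sizeEPPF α θ' n ≤ M := by
  set N := ∑ b, n b with hN
  have hkN : k + 1 ≤ N := by
    calc k + 1 = ∑ b : Fin (k + 1), 1 := by simp
      _ ≤ N := Finset.sum_le_sum fun b _ => Nat.one_le_iff_ne_zero.2 (hn b)
  obtain ⟨d, hd⟩ := Nat.exists_eq_add_of_le hkN
  refine ⟨1 / rising (θ + 1 + k) d * ∏ b, rising (1 - α) (n b - 1), fun θ' h => ?_⟩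
  rw [sizeEPPF, ← hN]
  refine mul_le_mul_of_nonneg_right ?_ (Finset.prod_nonneg fun b _ => (rising_pos (by linarith) _).le)
  have hk0 : (0 : ℝ) ≤ k := Nat.cast_nonneg k
  have hpos : 0 < rising (θ + 1 + k) d := rising_pos (by linarith) _
  have hpos' : 0 < rising (θ' + 1) k := rising_pos (by linarith) _
  -- The first k factors of the denominator dominate the numerator, since θ' + (i + 1)α ≤ θ' + 1 +
  -- i; the other d factors increase with θ'.
  rw [partitionWeight, show N - 1 = k + d by omega, Nat.add_sub_cancel, rising_add]
  have hle : rising (θ + 1 + k) d ≤ rising (θ' + 1 + k) d :=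
    rising_mono (by linarith) (by linarith) d
  have hnum : ∏ i ∈ Finset.range k, (θ' + (i + 1) * α) ≤ rising (θ' + 1) k := by
    refine Finset.prod_le_prod
      (fun i _ => (stick_param_pos hα0 (by linarith : -α < θ') i).le) fun i _ => ?_
    nlinarith [mul_nonneg (Nat.cast_nonneg (α := ℝ) i) (sub_nonneg.2 hα1.le)]
  rw [div_le_div_iff₀ (mul_pos hpos' (hpos.trans_le hle)) hpos, one_mul]
  exact mul_le_mul hnum hle hpos.le hpos'.le

end BlockSizes

/-- Iterating and using 1 - x ≤ exp(-x) bounds |f 0| by M exp(-c H_N), with H_N the harmonic sum,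
which diverges. -/
theorem eq_zero_of_contracting_recursion {f a : ℕ → ℝ} {c M : ℝ} (hc : 0 < c)
    (hf : ∀ r, f r = a r * f (r + 1)) (ha0 : ∀ r, 0 ≤ a r) (ha : ∀ r, a r ≤ 1 - c * (1 / (r + 1)))
    (hM : ∀ r, |f r| ≤ M) : f 0 = 0 := by
  have hM0 : 0 ≤ M := (abs_nonneg _).trans (hM 0)
  have h1 : ∀ N, |f 0| ≤ Real.exp (-c * ∑ i ∈ Finset.range N, 1 / ((i : ℝ) + 1)) * |f N| := by
    intro N
    induction N with
    | zero => simp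
    | succ N ih =>
      refine ih.trans ?_
      rw [hf N, abs_mul, abs_of_nonneg (ha0 N), Finset.sum_range_succ, mul_add, Real.exp_add,
        mul_assoc]
      gcongr
      refine (ha N).trans ?_
      have := Real.add_one_le_exp (-c * (1 / ((N : ℝ) + 1)))
      linarith
  have h2 : Filter.Tendsto
      (fun N => Real.exp (-c * ∑ i ∈ Finset.range N, 1 / ((i : ℝ) + 1)) * M)
      Filter.atTop (nhds (0 * M)) := by
    refine Filter.Tendsto.mul_const _ (Real.tendsto_exp_atBot.comp ?_)
    exact Real.tendsto_sum_range_one_div_nat_succ_atTop.const_mul_atTop_of_neg (by linarith)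
  rw [zero_mul] at h2
  refine abs_eq_zero.1 (le_antisymm (ge_of_tendsto' h2 fun N => (h1 N).trans ?_) (abs_nonneg _))
  gcongr
  exact hM N

/-! ### Expected products of weights equal the partition probability -/

section DistinctSumIntegral

variable {α θ : ℝ}

theorem lintegral_distinctSum_le_one (hα0 : 0 ≤ α) (hα1 : α < 1) (hθ : -α < θ) {k : ℕ}
    (n : Fin k → ℕ) (hn : ∀ b, n b ≠ 0) :
    ∫⁻ v, distinctSum (stickWeight v) n ∂stickLaw α θ ≤ 1 := by
  have := isProbabilityMeasure_stickLaw hα0 hα1 hθ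
  calc ∫⁻ v, distinctSum (stickWeight v) n ∂stickLaw α θ ≤ ∫⁻ _, 1 ∂stickLaw α θ := by
        refine lintegral_mono_ae ?_
        filter_upwards [ae_stickLaw_mem_Ioo hα0 hα1 hθ] with v hv
        exact distinctSum_le_one (tsum_stickWeight_le_one fun i => ⟨(hv i).1.le, (hv i).2.le⟩) n hn
    _ = 1 := by simp

/-- Integrate `distinctSum_succ` over the tail with the first stick fixed, then over the first stick
by the beta moment formula. -/
theorem lintegral_distinctSum_recursion (hα0 : 0 ≤ α) (hα1 : α < 1) (hθ : -α < θ) {k : ℕ}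
    (n : Fin (k + 1) → ℕ) :
    ∫⁻ v, distinctSum (stickWeight v) n ∂stickLaw α θ =
      ENNReal.ofReal (rising (θ + α) (∑ b, n b) / rising (θ + 1) (∑ b, n b)) *
          ∫⁻ v, distinctSum (stickWeight v) n ∂stickLaw α (θ + α) +
        ∑ b, ENNReal.ofReal (rising (1 - α) (n b) * rising (θ + α) (∑ i, n (b.succAbove i)) /
          rising (θ + 1) (∑ b, n b)) *
            ∫⁻ v, distinctSum (stickWeight v) (fun i => n (b.succAbove i))
              ∂stickLaw α (θ + α) := by
  have hp : 0 < 1 - α := by linarith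
  have hq : 0 < θ + α := by linarith
  have h1 := isProbabilityMeasureBeta hp hq
  have h2 := isProbabilityMeasure_stickLaw hα0 hα1 (by linarith : -α < θ + α)
  have hm : ∀ {j : ℕ} (n : Fin j → ℕ), Measurable fun v => distinctSum (stickWeight v) n :=
    fun n => measurable_distinctSum measurable_stickWeight n
  rw [stickLaw_eq_map hα0 hα1 hθ, lintegral_map (hm n) measurable_consSeq,
    lintegral_prod _ (by exact ((hm n).comp measurable_consSeq).aemeasurable)]
  simp_rw [stickWeight_consSeq, distinctSum_succ]
  have hpq : (1 - α) + (θ + α) = θ + 1 := by ring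
  -- The trivial factor `ENNReal.ofReal x ^ 0` puts the first term in the shape of a beta moment
  -- with first exponent 0.
  have hin : ∀ x : ℝ, ∫⁻ v, (ENNReal.ofReal (1 - x) ^ (∑ b, n b) * distinctSum (stickWeight v) n +
        ∑ b, ENNReal.ofReal x ^ n b * ENNReal.ofReal (1 - x) ^ (∑ i, n (b.succAbove i)) *
          distinctSum (stickWeight v) fun i => n (b.succAbove i)) ∂stickLaw α (θ + α) =
      ENNReal.ofReal x ^ 0 * ENNReal.ofReal (1 - x) ^ (∑ b, n b) *
          ∫⁻ v, distinctSum (stickWeight v) n ∂stickLaw α (θ + α) +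
        ∑ b, ENNReal.ofReal x ^ n b * ENNReal.ofReal (1 - x) ^ (∑ i, n (b.succAbove i)) *
          ∫⁻ v, distinctSum (stickWeight v) (fun i => n (b.succAbove i))
            ∂stickLaw α (θ + α) := by
    intro x
    rw [lintegral_add_left ((hm n).const_mul _), lintegral_const_mul _ (hm n),
      lintegral_finsetSum _ fun b _ => (hm _).const_mul _, pow_zero, one_mul]
    congr 1
    exact Finset.sum_congr rfl fun b _ => lintegral_const_mul _ (hm _)
  simp_rw [hin]
  rw [lintegral_add_left (by fun_prop), lintegral_mul_const _ (by fun_prop),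
    lintegral_betaMeasure_moment hp hq, lintegral_finsetSum _ fun b _ => by fun_prop, hpq]
  congr 1
  · simp
  · refine Finset.sum_congr rfl fun b _ => ?_
    rw [lintegral_mul_const _ (by fun_prop), lintegral_betaMeasure_moment hp hq, hpq,
      ← Fin.sum_univ_succAbove n b]

/-- The moments of the stick-breaking weights are given by the exchangeable partition probability
function. -/
theorem lintegral_distinctSum (hα0 : 0 ≤ α) (hα1 : α < 1) (hθ : -α < θ) {k : ℕ}
    (n : Fin k → ℕ) (hn : ∀ b, n b ≠ 0) :
    ∫⁻ v, distinctSum (stickWeight v) n ∂stickLaw α θ = ENNReal.ofReal (sizeEPPF α θ n) := by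
  induction k generalizing θ with
  | zero =>
    have := isProbabilityMeasure_stickLaw hα0 hα1 hθ
    simp [distinctSum_zero, sizeEPPF, partitionWeight]
  | succ k ih =>
    set F : ℝ → ℝ≥0∞ := fun θ => ∫⁻ v, distinctSum (stickWeight v) n ∂stickLaw α θ with hF
    have hF1 : ∀ {θ}, -α < θ → F θ ≤ 1 := fun h => lintegral_distinctSum_le_one hα0 hα1 h n hn
    have hFt : ∀ {θ}, -α < θ → F θ ≠ ⊤ := fun h => ((hF1 h).trans_lt ENNReal.one_lt_top).ne
    set a : ℝ → ℝ := fun θ => rising (θ + α) (∑ b, n b) / rising (θ + 1) (∑ b, n b) with ha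
    have ha0 : ∀ {θ}, -α < θ → 0 ≤ a θ := fun h =>
      div_nonneg (rising_pos (by linarith) _).le (rising_pos (by linarith) _).le
    -- The terms with one block fewer are known by the induction hypothesis and cancel in the
    -- difference of the two recursions.
    have hrec : ∀ {θ}, -α < θ →
        sizeEPPF α θ n - (F θ).toReal = a θ * (sizeEPPF α (θ + α) n - (F (θ + α)).toReal) := by
      intro θ h
      have h' : -α < θ + α := by linarith
      have hc : ∀ b, 0 ≤ rising (1 - α) (n b) * rising (θ + α) (∑ i, n (b.succAbove i)) /
          rising (θ + 1) (∑ b, n b) := fun b =>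
        div_nonneg (mul_nonneg (rising_pos (by linarith) _).le (rising_pos (by linarith) _).le)
          (rising_pos (by linarith) _).le
      have e1 := lintegral_distinctSum_recursion hα0 hα1 h n
      simp_rw [fun b : Fin (k + 1) => ih h' (fun i => n (b.succAbove i)) fun i => hn _,
        fun b => (ENNReal.ofReal_mul (hc b) (q := sizeEPPF α (θ + α) fun i =>
          n (b.succAbove i))).symm] at e1
      rw [← ENNReal.ofReal_sum_of_nonneg fun b _ =>
          mul_nonneg (hc b) (sizeEPPF_nonneg hα0 hα1 h' _)] at e1
      change F θ = ENNReal.ofReal (a θ) * F (θ + α) + _ at e1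
      rw [e1, ENNReal.toReal_add (ENNReal.mul_ne_top ENNReal.ofReal_ne_top (hFt h'))
        ENNReal.ofReal_ne_top, ENNReal.toReal_mul, ENNReal.toReal_ofReal (ha0 h),
        ENNReal.toReal_ofReal (Finset.sum_nonneg fun b _ =>
          mul_nonneg (hc b) (sizeEPPF_nonneg hα0 hα1 h' _)), sizeEPPF_recursion hα1 h n hn]
      ring
    obtain ⟨M, hM⟩ := exists_sizeEPPF_le hα0 hα1 hθ n hn
    have hr0 : ∀ r : ℕ, 0 ≤ (r : ℝ) * α := fun r => by positivity
    have hlt : ∀ r : ℕ, -α < θ + r * α := fun r => by linarith [hr0 r]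
    -- With t = θ + rα one has a(t) ≤ (t + α)/(t + 1) = 1 - (1 - α)/(t + 1), and t + 1 ≤ (θ + 2)(r +
    -- 1) explains the constant c. The bound is M + 1 because the integral is at most 1.
    have hzero := eq_zero_of_contracting_recursion
      (f := fun r : ℕ => sizeEPPF α (θ + r * α) n - (F (θ + r * α)).toReal)
      (a := fun r : ℕ => a (θ + r * α)) (c := (1 - α) / (θ + 2)) (M := M + 1)
      (div_pos (by linarith) (by linarith))
      (fun r => by
        have := hrec (hlt r)
        simp only [Nat.cast_add, Nat.cast_one]
        rw [this, add_assoc, ← add_one_mul])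
      (fun r => ha0 (hlt r))
      (fun r => by
        have hr := hlt r
        set t := θ + r * α with ht
        obtain ⟨N, hN⟩ : ∃ N, ∑ b, n b = N + 1 := Nat.exists_eq_succ_of_ne_zero fun h =>
          hn 0 ((Finset.sum_eq_zero_iff.1 h) 0 (Finset.mem_univ _))
        have hp1 : 0 < rising (t + 1 + 1) N := rising_pos (by linarith) _
        have hp2 : rising (t + α + 1) N ≤ rising (t + 1 + 1) N :=
          rising_mono (by linarith) (by linarith) _
        have hle : a t ≤ (t + α) / (t + 1) := by
          simp only [ha, hN, rising_succ_left]
          rw [div_le_div_iff₀ (mul_pos (by linarith) hp1) (by linarith)]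
          have : 0 ≤ (t + α) * (t + 1) := mul_nonneg (by linarith) (by linarith)
          nlinarith
        refine hle.trans ?_
        have hden : t + 1 ≤ (θ + 2) * (r + 1) := by
          have : 0 ≤ (r : ℝ) * (θ + 2 - α) := mul_nonneg (Nat.cast_nonneg r) (by linarith)
          nlinarith
        have e : (t + α) / (t + 1) = 1 - (1 - α) / (t + 1) := by
          have : t + 1 ≠ 0 := by linarith
          field_simp
          ring
        rw [e, div_mul_div_comm, mul_one]
        exact sub_le_sub_left (div_le_div_of_nonneg_left (by linarith) (by linarith) hden) 1)
      (fun r => by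
        have h1 := sizeEPPF_nonneg hα0 hα1 (hlt r) n
        have h2 := hM (θ + r * α) (by linarith [hr0 r])
        have h3 : (F (θ + r * α)).toReal ≤ 1 :=
          ENNReal.toReal_le_of_le_ofReal zero_le_one (by simpa using hF1 (hlt r))
        have h4 : 0 ≤ (F (θ + r * α)).toReal := ENNReal.toReal_nonneg
        rw [abs_le]
        constructor <;> linarith)
    simp only [CharP.cast_eq_zero, zero_mul, add_zero, sub_eq_zero] at hzero
    rw [hzero, ENNReal.ofReal_toReal (hFt hθ)]

end DistinctSumIntegral

/-! ### Set partitions as setoids, and their block products -/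

section SetPartitions

variable {ι κ β : Type}

instance finite_setoid [Finite ι] : Finite (Setoid ι) :=
  Finite.of_injective (fun s : Setoid ι => (s.r : ι → ι → Prop)) fun _ _ h =>
    Setoid.ext fun x y => iff_of_eq (congr_fun (congr_fun h x) y)

noncomputable instance fintypeSetoid [Finite ι] : Fintype (Setoid ι) := Fintype.ofFinite _

/-- The number of blocks of a set partition. -/
noncomputable def numBlocks (s : Setoid ι) : ℕ := Nat.card (Quotient s)

/-- The size of the fiber of `g` over `b`. -/
noncomputable def fiberCard (g : ι → β) (b : β) : ℕ := Nat.card {i // g i = b}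

/-- The size of a block of a set partition. -/
noncomputable def blockCard (s : Setoid ι) (q : Quotient s) : ℕ :=
  fiberCard (fun i => (⟦i⟧ : Quotient s)) q

/-- The factor of the probability of a set partition that is contributed by a block of size `n`. -/
noncomputable def blockWeight (α : ℝ) (n : ℕ) : ℝ := rising (1 - α) (n - 1)

/-- The product of the weights of the blocks of a set partition. -/
noncomputable def blockProd (α : ℝ) (s : Setoid ι) : ℝ :=
  ∏ᶠ q : Quotient s, blockWeight α (blockCard s q)

/-- The exchangeable partition probability function of the Pitman–Yor process. -/
noncomputable def eppf (α θ : ℝ) (s : Setoid ι) : ℝ :=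
  partitionWeight α θ (Nat.card ι) (numBlocks s) * blockProd α s

@[simp]
theorem blockWeight_zero (α : ℝ) : blockWeight α 0 = 1 := by simp [blockWeight]

@[simp]
theorem blockWeight_one (α : ℝ) : blockWeight α 1 = 1 := by simp [blockWeight]

theorem blockWeight_succ (α : ℝ) {n : ℕ} (hn : n ≠ 0) :
    blockWeight α (n + 1) = (n - α) * blockWeight α n := by
  obtain ⟨m, rfl⟩ := Nat.exists_eq_succ_of_ne_zero hn
  simp only [blockWeight, Nat.add_sub_cancel, Nat.succ_eq_add_one, rising_succ]
  push_cast
  ring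

theorem fiberCard_eq_zero {g : ι → β} {b : β} (h : b ∉ Set.range g) : fiberCard g b = 0 := by
  have : IsEmpty {i // g i = b} := ⟨fun i => h ⟨i.1, i.2⟩⟩
  simp [fiberCard]

theorem blockCard_ne_zero [Finite ι] (s : Setoid ι) (q : Quotient s) : blockCard s q ≠ 0 := by
  have : Nonempty {i // (⟦i⟧ : Quotient s) = q} := ⟨⟨q.out, q.out_eq⟩⟩
  exact Nat.card_pos.ne'

theorem sum_fiberCard [Finite ι] [Fintype β] (g : ι → β) : ∑ b, fiberCard g b = Nat.card ι := by
  rw [← Nat.card_congr (Equiv.sigmaFiberEquiv g), Nat.card_sigma]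
  rfl

theorem numBlocks_ker {E : Type*} (g : ι → E) : numBlocks (Setoid.ker g) = (Set.range g).ncard :=
  Nat.card_congr (Setoid.quotientKerEquivRange g)

theorem numBlocks_le [Finite ι] (s : Setoid ι) : numBlocks s ≤ Nat.card ι :=
  Nat.card_le_card_of_surjective _ Quotient.mk_surjective

theorem numBlocks_eq_zero_iff [Finite ι] (s : Setoid ι) : numBlocks s = 0 ↔ Nat.card ι = 0 := by
  have : Finite (Quotient s) := Quotient.finite s
  rw [numBlocks, Finite.card_eq_zero_iff, Finite.card_eq_zero_iff]
  exact ⟨fun h => ⟨fun i => h.elim ⟦i⟧⟩, fun _ => inferInstance⟩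

/-- Labels that are not attained contribute `blockWeight α 0 = 1`, a consequence of truncated
subtraction, so the product may run over the whole codomain. -/
theorem blockProd_ker (α : ℝ) (g : ι → β) :
    blockProd α (Setoid.ker g) = ∏ᶠ b, blockWeight α (fiberCard g b) := by
  have h1 : ∏ᶠ b, blockWeight α (fiberCard g b) =
      ∏ᶠ b ∈ Set.range (Setoid.kerLift g), blockWeight α (fiberCard g b) := by
    rw [finprod_mem_def]
    refine finprod_congr fun b => ?_
    rw [Setoid.range_kerLift_eq_range]
    by_cases hb : b ∈ Set.range g
    · rw [Set.mulIndicator_of_mem hb]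
    · rw [Set.mulIndicator_of_notMem hb, fiberCard_eq_zero hb, blockWeight_zero]
  rw [h1, finprod_mem_range (Setoid.kerLift_injective g), blockProd]
  refine finprod_congr fun q => ?_
  congr 1
  refine Nat.card_congr (Equiv.subtypeEquivRight fun i => ?_)
  rw [← (Setoid.kerLift_injective g).eq_iff]
  rfl

theorem numBlocks_comap_equiv (e : κ ≃ ι) (s : Setoid ι) : numBlocks (s.comap e) = numBlocks s := by
  rw [Setoid.comap_eq, numBlocks_ker, e.surjective.range_comp, Quotient.mk''_surjective.range_eq,
    Set.ncard_univ, numBlocks]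

theorem blockProd_comap_equiv (α : ℝ) (e : κ ≃ ι) (s : Setoid ι) :
    blockProd α (s.comap e) = blockProd α s := by
  rw [Setoid.comap_eq, blockProd_ker, blockProd]
  refine finprod_congr fun q => ?_
  congr 1
  exact Nat.card_congr (e.subtypeEquiv fun i => Iff.rfl)

theorem eppf_comap_equiv (α θ : ℝ) (e : κ ≃ ι) (s : Setoid ι) :
    eppf α θ (s.comap e) = eppf α θ s := by
  rw [eppf, eppf, numBlocks_comap_equiv, Nat.card_congr e]
  rw [blockProd_comap_equiv]

/-! ### Adding a point to a partition -/

section Option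

/-- The partition of `Option ι` obtained from a partition of `ι` by adding the new point to one of
the blocks, or to a new block. -/
def extendSetoid (s : Setoid ι) (o : Option (Quotient s)) : Setoid (Option ι) :=
  Setoid.ker fun x : Option ι => x.elim o fun i => some ⟦i⟧

theorem extendSetoid_none_some (s : Setoid ι) (o : Option (Quotient s)) (i : ι) :
    extendSetoid s o none (some i) ↔ o = some ⟦i⟧ := Iff.rfl

theorem extendSetoid_some_some (s : Setoid ι) (o : Option (Quotient s)) (x y : ι) :
    extendSetoid s o (some x) (some y) ↔ s x y := Option.some_inj.trans Quotient.eq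

theorem comap_extendSetoid (s : Setoid ι) (o : Option (Quotient s)) :
    (extendSetoid s o).comap some = s :=
  Setoid.ext fun x y => extendSetoid_some_some s o x y

/-- A partition of `Option ι` is determined by its trace on `ι` and by the block of the new
point. -/
theorem setoid_option_ext {t t' : Setoid (Option ι)} (h : t.comap some = t'.comap some)
    (h' : ∀ i, t none (some i) ↔ t' none (some i)) : t = t' := by
  refine Setoid.ext fun x y => ?_
  rcases x with _ | x <;> rcases y with _ | y
  · exact iff_of_true (t.refl' _) (t'.refl' _)
  · exact h' y
  · exact (t.comm').trans ((h' x).trans t'.comm')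
  · exact Setoid.ext_iff.1 h x y

theorem extendSetoid_bijective :
    Function.Bijective fun p : Σ s : Setoid ι, Option (Quotient s) => extendSetoid p.1 p.2 := by
  constructor
  · rintro ⟨s, o⟩ ⟨s', o'⟩ H
    have hs : s = s' := by
      rw [← comap_extendSetoid s o, ← comap_extendSetoid s' o']
      exact congr_arg _ H
    subst hs
    congr 1
    ext q
    obtain ⟨i, rfl⟩ := Quotient.mk_surjective q
    have : extendSetoid s o none (some i) ↔ extendSetoid s o' none (some i) :=
      iff_of_eq (congr_arg (fun t : Setoid (Option ι) => t none (some i)) H)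
    simpa [extendSetoid_none_some] using this
  · intro t
    by_cases h : ∃ i, t none (some i)
    · obtain ⟨i, hi⟩ := h
      refine ⟨⟨t.comap some, some ⟦i⟧⟩, setoid_option_ext (comap_extendSetoid _ _) fun j => ?_⟩
      rw [extendSetoid_none_some, Option.some_inj, Quotient.eq]
      exact ⟨fun H => t.trans' hi H, fun H => t.trans' (t.symm' hi) H⟩
    · push Not at h
      refine ⟨⟨t.comap some, none⟩, setoid_option_ext (comap_extendSetoid _ _) fun j => ?_⟩
      simpa [extendSetoid_none_some] using h j

theorem numBlocks_extendSetoid_some (s : Setoid ι) (q : Quotient s) :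
    numBlocks (extendSetoid s (some q)) = numBlocks s := by
  have h : (Set.range fun x : Option ι => x.elim (some q) fun i => some (⟦i⟧ : Quotient s)) =
      some '' Set.univ := by
    ext b
    constructor
    · rintro ⟨_ | x, rfl⟩ <;> simp
    · rintro ⟨q', -, rfl⟩
      exact ⟨some q'.out, by simp⟩
  rw [extendSetoid, numBlocks_ker, h, Set.ncard_image_of_injective _ (Option.some_injective _),
    Set.ncard_univ, numBlocks]

variable [Finite ι]

theorem fiberCard_elim_none (s : Setoid ι) (o : Option (Quotient s)) (b : Option (Quotient s)) :
    fiberCard (fun x : Option ι => x.elim o fun i => some ⟦i⟧) b =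
      b.elim 0 (blockCard s) + Nat.card {_x : Unit // o = b} := by
  have e : {x : Option ι // x.elim o (fun i => some ⟦i⟧) = b} ≃
      {i : ι // some (⟦i⟧ : Quotient s) = b} ⊕ {_x : Unit // o = b} :=
    ((Equiv.optionEquivSumPUnit ι).subtypeEquiv (q := fun x =>
      Sum.elim (fun i => some (⟦i⟧ : Quotient s)) (fun _ => o) x = b)
      fun x => by cases x <;> simp).trans Equiv.subtypeSum
  rw [fiberCard, Nat.card_congr e, Nat.card_sum]
  congr 1
  cases b with
  | none => simp
  | some q => simp [blockCard, fiberCard]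

theorem blockProd_extendSetoid_none (α : ℝ) (s : Setoid ι) :
    blockProd α (extendSetoid s none) = blockProd α s := by
  have := Fintype.ofFinite (Quotient s)
  rw [extendSetoid, blockProd_ker, blockProd, finprod_eq_prod_of_fintype,
    finprod_eq_prod_of_fintype, Fintype.prod_option]
  simp [fiberCard_elim_none]

theorem blockProd_extendSetoid_some (α : ℝ) (s : Setoid ι) (q : Quotient s) :
    blockProd α (extendSetoid s (some q)) = (blockCard s q - α) * blockProd α s := by
  classical
  have := Fintype.ofFinite (Quotient s)
  rw [extendSetoid, blockProd_ker, blockProd, finprod_eq_prod_of_fintype,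
    finprod_eq_prod_of_fintype, Fintype.prod_option, ← Finset.mul_prod_erase _ _ (Finset.mem_univ q),
    ← Finset.mul_prod_erase _ _ (Finset.mem_univ q)]
  simp only [fiberCard_elim_none]
  simp only [Option.elim, reduceCtorEq, Nat.card_of_isEmpty, add_zero, blockWeight_zero, one_mul]
  rw [← mul_assoc]
  congr 1
  · rw [← blockWeight_succ α (blockCard_ne_zero s q)]
    simp
  · refine Finset.prod_congr rfl fun q' hq' => ?_
    have : q ≠ q' := (Finset.ne_of_mem_erase hq').symm
    simp [this]

theorem numBlocks_extendSetoid_none (s : Setoid ι) :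
    numBlocks (extendSetoid s none) = numBlocks s + 1 := by
  rw [extendSetoid, numBlocks_ker, numBlocks, ← Finite.card_option, ← Set.ncard_univ]
  congr 1
  rw [Set.range_eq_univ]
  rintro (_ | q)
  · exact ⟨none, rfl⟩
  · exact ⟨some q.out, by simp⟩

/-- The new point opens a block, with factor 1, or joins a block q, with factor |q| - α; the factors
of the second kind add up to n - kα. -/
theorem sum_setoid_option (α : ℝ) (ψ : Setoid ι → ℕ → ℝ) :
    ∑ t : Setoid (Option ι), ψ (t.comap some) (numBlocks t) * blockProd α t =
      ∑ s : Setoid ι, (ψ s (numBlocks s + 1) + (Nat.card ι - numBlocks s * α) * ψ s (numBlocks s)) *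
        blockProd α s := by
  have := fun s : Setoid ι => Fintype.ofFinite (Quotient s)
  rw [← Fintype.sum_equiv (Equiv.ofBijective _ extendSetoid_bijective) _ _ fun _ => rfl,
    Fintype.sum_sigma]
  refine Finset.sum_congr rfl fun s _ => ?_
  rw [Fintype.sum_option]
  simp only [Equiv.ofBijective_apply, comap_extendSetoid, numBlocks_extendSetoid_none,
    numBlocks_extendSetoid_some, blockProd_extendSetoid_none, blockProd_extendSetoid_some]
  rw [← Finset.mul_sum, ← Finset.sum_mul, Finset.sum_sub_distrib, ← Nat.cast_sum]
  have h : ∑ q, blockCard s q = Nat.card ι := sum_fiberCard _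
  rw [h, Finset.sum_const, Finset.card_univ, ← Nat.card_eq_fintype_card, nsmul_eq_mul]
  change _ + _ * ((_ - (numBlocks s : ℝ) * α) * _) = _
  ring

end Option

end SetPartitions

/-! ### The number of blocks and the generalized factorial coefficients -/

section DistinctValues

variable {α θ : ℝ}

/-- The sum of the block products of the partitions of `n` points into `k` blocks. -/
def partitionSum (α : ℝ) : ℕ → ℕ → ℝ
  | 0, 0 => 1
  | 0, _ + 1 => 0
  | n + 1, 0 => n * partitionSum α n 0
  | n + 1, k + 1 => partitionSum α n k + (n - (k + 1) * α) * partitionSum α n (k + 1)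

theorem partitionSum_succ_zero (α : ℝ) (n : ℕ) : partitionSum α (n + 1) 0 = 0 := by
  induction n with
  | zero => simp [partitionSum]
  | succ n ih => rw [partitionSum, ih, mul_zero]

theorem sum_setoid_comap_equiv {ι κ : Type} [Finite ι] [Finite κ] (e : κ ≃ ι) (Φ : Setoid κ → ℝ) :
    ∑ s : Setoid ι, Φ (s.comap e) = ∑ s : Setoid κ, Φ s :=
  Fintype.sum_equiv
    { toFun := Setoid.comap e
      invFun := Setoid.comap e.symm
      left_inv := fun s => by rw [← Setoid.comap_comp]; simp [Setoid.comap_id]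
      right_inv := fun s => by rw [← Setoid.comap_comp]; simp [Setoid.comap_id] }
    _ _ fun _ => rfl

theorem sum_blockProd_eq_partitionSum (α : ℝ) (ι : Type) [Finite ι] (k : ℕ) :
    ∑ s : Setoid ι, (if numBlocks s = k then blockProd α s else 0) =
      partitionSum α (Nat.card ι) k := by
  induction hn : Nat.card ι generalizing ι k with
  | zero =>
    have : IsEmpty ι := Finite.card_eq_zero_iff.1 hn
    have : Unique (Setoid ι) := ⟨⟨⊤⟩, fun s => Setoid.ext fun x => isEmptyElim x⟩
    have h0 : numBlocks (default : Setoid ι) = 0 := (numBlocks_eq_zero_iff _).2 hn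
    rw [Fintype.sum_unique, h0]
    cases k <;> simp [partitionSum, blockProd, finprod_of_isEmpty]
  | succ n ih =>
    have e : Option (Fin n) ≃ ι := (finSuccEquiv n).symm.trans (Finite.equivFinOfCardEq hn).symm
    rw [← sum_setoid_comap_equiv e.symm]
    simp_rw [numBlocks_comap_equiv, blockProd_comap_equiv]
    have h := sum_setoid_option α (fun (_ : Setoid (Fin n)) j => if j = k then (1 : ℝ) else 0)
    simp only [ite_mul, one_mul, zero_mul] at h
    rw [h, Nat.card_fin]
    have ih' := fun j => ih (Fin n) j (Nat.card_fin n)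
    cases k with
    | zero =>
      rw [partitionSum, ← ih' 0, Finset.mul_sum]
      refine Finset.sum_congr rfl fun s _ => ?_
      by_cases hs : numBlocks s = 0 <;> simp [hs]
    | succ k =>
      rw [partitionSum, ← ih' k, ← ih' (k + 1), Finset.mul_sum, ← Finset.sum_add_distrib]
      refine Finset.sum_congr rfl fun s _ => ?_
      by_cases hs : numBlocks s = k
      · simp [hs]
      · by_cases hs' : numBlocks s = k + 1 <;> simp [hs, hs']

theorem partitionSum_zero_eq_stirlingFirst (n k : ℕ) :
    partitionSum 0 n k = n.stirlingFirst k := by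
  induction n generalizing k with
  | zero => cases k <;> simp [partitionSum]
  | succ n ih =>
    cases k with
    | zero => simp [partitionSum_succ_zero]
    | succ k =>
      rw [partitionSum, ih, ih, Nat.stirlingFirst_succ_succ]
      push_cast
      ring

theorem genFactCoeff_zero (k : ℕ) (α : ℝ) : genFactCoeff 0 k α = if k = 0 then 1 else 0 := by
  have h := Int.alternating_sum_range_choose (n := k)
  have h' : ∑ i ∈ Finset.range (k + 1), (k.choose i : ℝ) * (-1) ^ i = if k = 0 then 1 else 0 := by
    have := congr_arg (Int.cast : ℤ → ℝ) h
    push_cast at this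
    rw [← this]
    exact Finset.sum_congr rfl fun i _ => mul_comm _ _
  simp only [genFactCoeff, rising_zero, mul_one, h']
  split_ifs with hk <;> simp [hk]

theorem genFactCoeff_succ_zero (n : ℕ) (α : ℝ) : genFactCoeff (n + 1) 0 α = 0 := by
  simp [genFactCoeff, rising_succ_left]

/-- The new factor n - iα is split as (n - (k + 1)α) + (k + 1 - i)α, and C(k+1, i)(k + 1 - i) = (k +
1) C(k, i) lowers the second part from k + 1 to k. -/
theorem genFactCoeff_succ_succ (n k : ℕ) (α : ℝ) :
    genFactCoeff (n + 1) (k + 1) α =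
      α * genFactCoeff n k α + (n - (k + 1) * α) * genFactCoeff n (k + 1) α := by
  have h : ∀ i ∈ Finset.range (k + 2),
      ((k + 1).choose i : ℝ) * (-1) ^ i * rising (-(i * α)) (n + 1) =
        (n - (k + 1) * α) * (((k + 1).choose i : ℝ) * (-1) ^ i * rising (-(i * α)) n) +
          α * (k + 1) * ((k.choose i : ℝ) * (-1) ^ i * rising (-(i * α)) n) := by
    intro i hi
    have hi' : i ≤ k + 1 := by simpa [Nat.lt_succ_iff] using hi
    have hc : ((k + 1).choose i : ℝ) * (k + 1 - i) = (k + 1) * k.choose i := by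
      have := congr_arg (Nat.cast : ℕ → ℝ) (Nat.choose_mul_succ_eq k i)
      push_cast [Nat.cast_sub hi'] at this
      linarith
    rw [rising_succ]
    linear_combination (-1) ^ i * rising (-(i * α)) n * α * hc
  rw [genFactCoeff, Finset.sum_congr rfl h, Finset.sum_add_distrib, ← Finset.mul_sum,
    ← Finset.mul_sum, Finset.sum_range_succ (fun i => (k.choose i : ℝ) * (-1) ^ i * _)]
  rw [genFactCoeff, genFactCoeff, Nat.choose_succ_self, Nat.factorial_succ]
  have := Nat.factorial_ne_zero k
  push_cast
  field_simp
  ring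

theorem genFactCoeff_eq (n k : ℕ) (α : ℝ) :
    genFactCoeff n k α = α ^ k * partitionSum α n k := by
  induction n generalizing k with
  | zero => cases k <;> simp [genFactCoeff_zero, partitionSum]
  | succ n ih =>
    cases k with
    | zero => simp [genFactCoeff_succ_zero, partitionSum_succ_zero]
    | succ k =>
      rw [genFactCoeff_succ_succ, ih, ih, partitionSum]
      ring

theorem prod_add_succ_mul (α θ : ℝ) (k : ℕ) :
    ∏ i ∈ Finset.range (k + 1), (θ + i * α) =
      θ * ∏ i ∈ Finset.range k, (θ + (i + 1) * α) := by
  rw [Finset.prod_range_succ']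
  simp [mul_comm]

theorem rising_div_mul_pow {α : ℝ} (hα : α ≠ 0) (θ : ℝ) (k : ℕ) :
    rising (θ / α) k * α ^ k = ∏ i ∈ Finset.range k, (θ + i * α) := by
  rw [rising, show α ^ k = ∏ _i ∈ Finset.range k, α by simp, ← Finset.prod_mul_distrib]
  refine Finset.prod_congr rfl fun i _ => ?_
  field_simp

/-- `partitionWeight` has the common factor θ already cancelled, so this single formula covers the
generic case and both limiting conventions. -/
theorem distinctPMF_eq (hα0 : 0 ≤ α) (hα1 : α < 1) (hθ : -α < θ) (n k : ℕ) :
    distinctPMF α θ n k = partitionWeight α θ n k * partitionSum α n k := by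
  rcases n with _ | n
  · rcases k with _ | k
    · simp [distinctPMF, partitionWeight, partitionSum, genFactCoeff_zero]
    · simp [distinctPMF, partitionSum, genFactCoeff_zero]
  rcases k with _ | k
  · simp [distinctPMF, partitionSum_succ_zero, genFactCoeff_succ_zero]
  have hr := (rising_pos (show 0 < θ + 1 by linarith) n).ne'
  rw [partitionWeight, Nat.add_sub_cancel, Nat.add_sub_cancel, distinctPMF]
  split_ifs with h1 h2
  · subst h1
    have hθ0 : θ ≠ 0 := by linarith
    rw [partitionSum_zero_eq_stirlingFirst, rising_succ_left, pow_succ']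
    simp only [mul_zero, add_zero, Finset.prod_const, Finset.card_range]
    field_simp
  · obtain ⟨rfl, -⟩ := h2
    rw [genFactCoeff_eq, Nat.add_sub_cancel, Nat.add_sub_cancel, zero_add]
    rw [zero_add] at hr
    have : ∏ i ∈ Finset.range k, (0 + ((i : ℝ) + 1) * α) = α ^ k * rising 1 k := by
      rw [rising, show α ^ k = ∏ _i ∈ Finset.range k, α by simp, ← Finset.prod_mul_distrib]
      exact Finset.prod_congr rfl fun i _ => by ring
    rw [this]
    field_simp
    ring
  · have hθ0 : θ ≠ 0 := by simpa using h2
    rw [genFactCoeff_eq, ← mul_assoc, div_mul_eq_mul_div, rising_div_mul_pow h1, prod_add_succ_mul,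
      rising_succ_left, mul_div_mul_left _ _ hθ0]

theorem sum_eppf_of_numBlocks (hα0 : 0 ≤ α) (hα1 : α < 1) (hθ : -α < θ) (ι : Type) [Finite ι]
    (k : ℕ) :
    ∑ s : Setoid ι, (if numBlocks s = k then eppf α θ s else 0) =
      distinctPMF α θ (Nat.card ι) k := by
  rw [distinctPMF_eq hα0 hα1 hθ, ← sum_blockProd_eq_partitionSum, Finset.mul_sum]
  refine Finset.sum_congr rfl fun s _ => ?_
  split_ifs with h
  · rw [eppf, h]
  · simp

theorem sum_eppf_mul_pow_numBlocks (hα0 : 0 ≤ α) (hα1 : α < 1) (hθ : -α < θ) (ι : Type) [Finite ι]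
    (x : ℝ) :
    ∑ s : Setoid ι, eppf α θ s * x ^ numBlocks s = distinctPGF (Nat.card ι) x α θ := by
  simp_rw [distinctPGF, ← sum_eppf_of_numBlocks hα0 hα1 hθ, Finset.mul_sum]
  rw [Finset.sum_comm]
  refine Finset.sum_congr rfl fun s _ => ?_
  have := numBlocks_le s
  simp only [mul_ite, mul_zero]
  rw [Finset.sum_ite_eq, if_pos (by simpa [Nat.lt_succ_iff] using this), mul_comm]

end DistinctValues

/-! ### Restriction of the random partition to a subset -/

section Consistency

variable {α θ : ℝ}

/-- Away from the empty case the two numerators combine through (θ + kα) + (n - kα) = θ + n, the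
extra factor of the denominator. The hypothesis on `n` and `k` keeps the truncated subtractions
harmless. -/
theorem partitionWeight_step (hθ : -1 < θ) {n k : ℕ} (h : k = 0 ↔ n = 0) :
    partitionWeight α θ (n + 1) (k + 1) + (n - k * α) * partitionWeight α θ (n + 1) k =
      partitionWeight α θ n k := by
  rcases n with _ | n
  · simp [h.2 rfl, partitionWeight]
  · obtain ⟨k, rfl⟩ := Nat.exists_eq_succ_of_ne_zero (mt h.1 n.succ_ne_zero)
    have h1 := (rising_pos (show 0 < θ + 1 by linarith) n).ne'
    have h2 : θ + 1 + n ≠ 0 := by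
      have : (0 : ℝ) ≤ n := Nat.cast_nonneg n
      linarith
    simp only [partitionWeight, Nat.succ_eq_add_one, Nat.add_sub_cancel, Finset.prod_range_succ,
      rising_succ]
    generalize ∏ i ∈ Finset.range k, (θ + ((i : ℝ) + 1) * α) = A
    push_cast
    field_simp
    ring

theorem sum_eppf_option (hθ : -1 < θ) {ι : Type} [Finite ι] (u : Setoid ι → ℝ) :
    ∑ t : Setoid (Option ι), eppf α θ t * u (t.comap some) = ∑ s : Setoid ι, eppf α θ s * u s := by
  have h := sum_setoid_option α fun (s : Setoid ι) k =>
    partitionWeight α θ (Nat.card ι + 1) k * u s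
  calc _ = _ := Finset.sum_congr rfl fun t _ => by rw [eppf, Finite.card_option]; ring
    _ = _ := h
    _ = _ := Finset.sum_congr rfl fun s _ => by
      rw [eppf, ← partitionWeight_step hθ (numBlocks_eq_zero_iff s)]; ring

/-- The random partitions of different finite sets are consistent. -/
theorem sum_eppf_comap (hθ : -1 < θ) {ι κ : Type} [Finite ι] [Finite κ] (f : κ → ι)
    (hf : Function.Injective f) (u : Setoid κ → ℝ) :
    ∑ t : Setoid ι, eppf α θ t * u (t.comap f) = ∑ s : Setoid κ, eppf α θ s * u s := by
  classical
  obtain ⟨d, hd⟩ := Nat.exists_eq_add_of_le (Nat.card_le_card_of_injective f hf)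
  -- The induction is on the number of points outside the range of `f`; such points are deleted one
  -- at a time.
  induction d generalizing ι with
  | zero =>
    have hb : Function.Bijective f := (Nat.bijective_iff_injective_and_card f).2 ⟨hf, by omega⟩
    rw [← sum_setoid_comap_equiv (Equiv.ofBijective f hb)]
    exact Finset.sum_congr rfl fun s _ => by rw [eppf_comap_equiv]; rfl
  | succ d ih =>
    obtain ⟨a, ha⟩ : ∃ a, a ∉ Set.range f := by
      by_contra! h
      have := Nat.card_le_card_of_surjective f h
      omega
    set e : Option {x // x ≠ a} ≃ ι := Equiv.optionSubtypeNe a with he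
    have hfa : ∀ x, f x ≠ a := fun x hx => ha ⟨x, hx⟩
    have hcard : Nat.card {x // x ≠ a} = Nat.card κ + d := by
      have := Nat.card_congr e
      rw [Finite.card_option] at this
      omega
    set g : κ → {x // x ≠ a} := fun x => ⟨f x, hfa x⟩ with hg
    have hgi : Function.Injective g := fun x y hxy => hf (congr_arg Subtype.val hxy)
    have hf' : f = e ∘ some ∘ g := by
      ext x
      simp [he, hg]
    calc ∑ t : Setoid ι, eppf α θ t * u (t.comap f)
        = ∑ t : Setoid ι, eppf α θ (t.comap e) * u (((t.comap e).comap some).comap g) :=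
          Finset.sum_congr rfl fun t _ => by
            rw [eppf_comap_equiv, hf', Setoid.comap_comp, Setoid.comap_comp]
      _ = ∑ t : Setoid (Option {x // x ≠ a}), eppf α θ t * u ((t.comap some).comap g) :=
          sum_setoid_comap_equiv e fun t => eppf α θ t * u ((t.comap some).comap g)
      _ = ∑ t : Setoid {x // x ≠ a}, eppf α θ t * u (t.comap g) :=
          sum_eppf_option hθ fun t => u (t.comap g)
      _ = _ := ih g hgi hcard

end Consistency

/-! ### Removing the block of a point -/

section BlockRemoval

variable {α θ : ℝ} {ι : Type}

open Classical in
/-- The partition that consists of `B` and of the blocks of a partition of the complement. -/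
noncomputable def glueBlock (B : Set ι) (s : Setoid {x // x ∉ B}) : Setoid ι :=
  Setoid.ker fun x => if h : x ∈ B then none else some (⟦⟨x, h⟩⟧ : Quotient s)

theorem comap_glueBlock (B : Set ι) (s : Setoid {x // x ∉ B}) :
    (glueBlock B s).comap Subtype.val = s := by
  refine Setoid.ext fun x y => ?_
  rw [Setoid.comap_rel, glueBlock, Setoid.ker_def, dif_neg x.2, dif_neg y.2, Option.some_inj,
    Quotient.eq]

theorem glueBlock_iff_mem {B : Set ι} {a : ι} (ha : a ∈ B) (s : Setoid {x // x ∉ B}) (x : ι) :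
    glueBlock B s x a ↔ x ∈ B := by
  rw [glueBlock, Setoid.ker_def, dif_pos ha]
  by_cases hx : x ∈ B <;> simp [hx]

theorem glueBlock_comap {B : Set ι} {a : ι} {t : Setoid ι} (h : ∀ x, t x a ↔ x ∈ B) :
    glueBlock B (t.comap Subtype.val) = t := by
  have ha : a ∈ B := (h a).1 (t.refl' a)
  refine Setoid.ext fun x y => ?_
  by_cases hx : x ∈ B
  · have h1 := (glueBlock_iff_mem ha (t.comap Subtype.val) x).2 hx
    have h2 := (h x).2 hx
    constructor
    · intro H
      have := (glueBlock_iff_mem ha _ y).1 (Setoid.trans' _ (Setoid.symm' _ H) h1)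
      exact t.trans' h2 (t.symm' ((h y).2 this))
    · intro H
      have := (h y).1 (t.trans' (t.symm' H) h2)
      exact Setoid.trans' _ h1 (Setoid.symm' _ ((glueBlock_iff_mem ha _ y).2 this))
  · by_cases hy : y ∈ B
    · refine iff_of_false (fun H => hx ?_) fun H => hx ?_
      · exact (glueBlock_iff_mem ha _ x).1
          (Setoid.trans' _ H ((glueBlock_iff_mem ha _ y).2 hy))
      · exact (h x).1 (t.trans' H ((h y).2 hy))
    · rw [glueBlock, Setoid.ker_def, dif_neg hx, dif_neg hy, Option.some_inj, Quotient.eq]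
      rfl

open Classical in
theorem sum_setoid_of_block [Finite ι] {B : Set ι} {a : ι} (ha : a ∈ B) (Φ : Setoid ι → ℝ) :
    ∑ s : Setoid ι, (if ∀ x, s x a ↔ x ∈ B then Φ s else 0) =
      ∑ s : Setoid {x // x ∉ B}, Φ (glueBlock B s) := by
  rw [← Finset.sum_filter]
  refine Finset.sum_nbij' (fun s => s.comap Subtype.val) (fun s => glueBlock B s) ?_ ?_ ?_ ?_ ?_
  · simp
  · intro s _
    simpa using glueBlock_iff_mem ha s
  · intro s hs
    exact glueBlock_comap (by simpa using hs)
  · intro s _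
    exact comap_glueBlock B s
  · intro s hs
    rw [glueBlock_comap (by simpa using hs)]

theorem numBlocks_glueBlock [Finite ι] {B : Set ι} (hB : B.Nonempty) (s : Setoid {x // x ∉ B}) :
    numBlocks (glueBlock B s) = numBlocks s + 1 := by
  rw [glueBlock, numBlocks_ker, numBlocks, ← Finite.card_option, ← Set.ncard_univ]
  congr 1
  rw [Set.range_eq_univ]
  obtain ⟨a, ha⟩ := hB
  rintro (_ | q)
  · exact ⟨a, dif_pos ha⟩
  · refine ⟨q.out.1, ?_⟩
    simp [q.out.2]

theorem blockProd_glueBlock [Finite ι] (B : Set ι) (s : Setoid {x // x ∉ B}) :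
    blockProd α (glueBlock B s) = blockWeight α B.ncard * blockProd α s := by
  have := Fintype.ofFinite (Quotient s)
  rw [glueBlock, blockProd_ker, blockProd, finprod_eq_prod_of_fintype,
    finprod_eq_prod_of_fintype, Fintype.prod_option]
  congr 1
  · congr 1
    refine Nat.card_congr (Equiv.subtypeEquivRight fun x => ?_)
    by_cases hx : x ∈ B <;> simp [hx]
  · refine Finset.prod_congr rfl fun q _ => ?_
    congr 1
    refine Nat.card_congr ⟨fun x => ⟨⟨x.1, fun hx => ?_⟩, ?_⟩, fun x => ⟨x.1.1, ?_⟩, fun _ => rfl,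
      fun _ => rfl⟩
    · simpa [hx] using x.2
    · have h := x.2
      dsimp only at h
      split_ifs at h with hx
      simpa using h
    · simpa [x.1.2] using x.2

/-- The removal of the block of a point from the random partition with parameter `θ` leaves a random
partition with parameter `θ + α`. -/
theorem sum_eppf_of_block (hθ : -α < θ) [Finite ι] {B : Set ι} {a : ι}
    (ha : a ∈ B) (u : Setoid {x // x ∉ B} → ℝ) [DecidablePred fun s : Setoid ι => ∀ x, s x a ↔ x ∈ B] :
    ∑ s : Setoid ι, (if ∀ x, s x a ↔ x ∈ B then eppf α θ s * u (s.comap Subtype.val) else 0) =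
      rising (1 - α) (B.ncard - 1) * rising (θ + α) (Nat.card ι - B.ncard) /
        rising (θ + 1) (Nat.card ι - 1) * ∑ s, eppf α (θ + α) s * u s := by
  have hcard : Nat.card {x // x ∉ B} = Nat.card ι - B.ncard := by
    rw [← Set.ncard_compl]; rfl
  have h := sum_setoid_of_block ha fun s => eppf α θ s * u (s.comap Subtype.val)
  rw [Finset.mul_sum]
  refine (Finset.sum_congr rfl fun s _ => by congr).trans (h.trans ?_)
  refine Finset.sum_congr rfl fun s _ => ?_
  -- The glued partition has one block more, so its numerator is a product over all `numBlocks s`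
  -- indices; this identity turns it into the weight with parameter θ + α.
  have hr := rising_mul_partitionWeight hθ (numBlocks_eq_zero_iff s).symm
  rw [comap_glueBlock, eppf, eppf, numBlocks_glueBlock ⟨a, ha⟩, blockProd_glueBlock,
    partitionWeight, Nat.add_sub_cancel, ← hr, ← hcard, blockWeight]
  ring

end BlockRemoval

/-! ### From index tuples to block labels -/

section PartitionSums

open Classical in
-- Index tuples with kernel `s` are exactly the injective labellings of its blocks, and equal
-- factors are collected blockwise.
theorem tsum_prod_of_ker_eq {ι : Type} [Fintype ι] (w : ℕ → ℝ≥0∞) (s : Setoid ι) {k : ℕ}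
    (σ : Quotient s ≃ Fin k) :
    ∑' I : ι → ℕ, (if Setoid.ker I = s then ∏ i, w (I i) else 0) =
      distinctSum w fun b => blockCard s (σ.symm b) := by
  set g : (Fin k ↪ ℕ) → ι → ℕ := fun e i => e (σ ⟦i⟧) with hg
  have hker : ∀ e, Setoid.ker (g e) = s := fun e => Setoid.ext fun x y => by
    simp [Setoid.ker_def, hg, Quotient.eq]
  have hinj : Function.Injective g := fun e e' H => by
    ext b
    obtain ⟨i, hi⟩ := Quotient.mk_surjective (σ.symm b)
    have := congr_fun H i
    simpa [hg, hi] using this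
  rw [← hinj.tsum_eq, distinctSum]
  · refine tsum_congr fun e => ?_
    rw [if_pos (hker e), ← Finset.prod_fiberwise' Finset.univ (fun i => σ ⟦i⟧) fun b => w (e b)]
    refine Finset.prod_congr rfl fun b _ => ?_
    rw [Finset.prod_const]
    congr 1
    rw [blockCard, fiberCard, Nat.card_eq_fintype_card, Fintype.card_subtype]
    congr 1
    ext i
    simp [Equiv.eq_symm_apply]
  · intro I hI
    have hI' : Setoid.ker I = s := by
      by_contra h
      simp [h] at hI
    subst hI'
    refine ⟨⟨fun b => Setoid.kerLift I (σ.symm b),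
      (Setoid.kerLift_injective I).comp σ.symm.injective⟩, ?_⟩
    ext i
    simp [hg, Setoid.kerLift_mk]

theorem sizeEPPF_blockCard {ι : Type} [Finite ι] (α θ : ℝ) (s : Setoid ι) {k : ℕ}
    (σ : Quotient s ≃ Fin k) :
    sizeEPPF α θ (fun b => blockCard s (σ.symm b)) = eppf α θ s := by
  have := Fintype.ofFinite (Quotient s)
  have h1 : ∑ b, blockCard s (σ.symm b) = Nat.card ι := by
    rw [Equiv.sum_comp σ.symm (blockCard s)]
    exact sum_fiberCard _
  have h2 : numBlocks s = k := by
    rw [numBlocks, Nat.card_congr σ, Nat.card_fin]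
  rw [sizeEPPF, eppf, h1, h2, blockProd, finprod_eq_prod_of_fintype,
    ← Equiv.prod_comp σ.symm fun q => blockWeight α (blockCard s q)]
  rfl

open Classical in
theorem lintegral_tsum_prod_of_ker_eq {α θ : ℝ} (hα0 : 0 ≤ α) (hα1 : α < 1) (hθ : -α < θ)
    {ι : Type} [Fintype ι] (s : Setoid ι) :
    ∫⁻ v, ∑' I : ι → ℕ, (if Setoid.ker I = s then ∏ i, stickWeight v (I i) else 0) ∂stickLaw α θ =
      ENNReal.ofReal (eppf α θ s) := by
  have σ : Quotient s ≃ Fin (Nat.card (Quotient s)) := Finite.equivFin _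
  simp_rw [tsum_prod_of_ker_eq _ s σ]
  rw [lintegral_distinctSum hα0 hα1 hθ _ fun b => blockCard_ne_zero s _, sizeEPPF_blockCard]

end PartitionSums

/-! ### The partition generated by a Pitman–Yor sample -/

section Sample

variable {V : Type*} [MeasurableSpace V]

/-- The joint law of the sticks and of the atoms of the Pitman–Yor process. -/
noncomputable def atomLaw (α θ : ℝ) (ν : Measure V) : Measure ((ℕ → ℝ) × (ℕ → V)) :=
  (stickLaw α θ).prod (Measure.infinitePi fun _ : ℕ => ν)

theorem pypLaw_eq_map (α θ : ℝ) (ν : Measure V) :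
    pypLaw α θ ν = (atomLaw α θ ν).map stickBreaking := rfl

theorem stickBreaking_apply {p : (ℕ → ℝ) × (ℕ → V)} (hp : ∀ i, p.1 i ≤ 1) {s : Set V}
    (hs : MeasurableSet s) :
    stickBreaking p s = ∑' j, stickWeight p.1 j * s.indicator 1 (p.2 j) := by
  rw [stickBreaking, Measure.sum_apply _ hs]
  refine tsum_congr fun j => ?_
  rw [Measure.smul_apply, smul_eq_mul, Measure.dirac_apply' _ hs, ofReal_stick_eq_stickWeight hp]

variable {α θ : ℝ} {ν : Measure V}

theorem ae_atomLaw_stick_le_one (hα0 : 0 ≤ α) (hα1 : α < 1) (hθ : -α < θ) :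
    ∀ᵐ p ∂atomLaw α θ ν, ∀ i, p.1 i ≤ 1 := by
  have := isProbabilityMeasure_stickLaw hα0 hα1 hθ
  have h := ae_stickLaw_mem_Ioo hα0 hα1 hθ
  exact Measure.quasiMeasurePreserving_fst.ae (h.mono fun v hv i => (hv i).2.le)

variable {Ω : Type*} [MeasurableSpace Ω] {μ : Measure Ω} [IsProbabilityMeasure μ]
  {P : Ω → Measure V} {n : ℕ} {X : Fin n → Ω → V}

/-- The law of a sample from a Pitman–Yor process is a mixture, over the indices of the sampled
atoms. -/
theorem map_sample_eq_sum (hα0 : 0 ≤ α) (hα1 : α < 1) (hθ : -α < θ)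
    (hP : HasLaw P (pypLaw α θ ν) μ) (hX : IsSampleFrom μ X P) :
    μ.map (fun ω i => X i ω) = Measure.sum fun I : Fin n → ℕ =>
      ((atomLaw α θ ν).withDensity fun p => ∏ i, stickWeight p.1 (I i)).map
        fun p i => p.2 (I i) := by
  have hXm : Measurable fun ω i => X i ω := measurable_pi_lambda _ hX.1
  have hd : ∀ I : Fin n → ℕ, Measurable fun p : (ℕ → ℝ) × (ℕ → V) => ∏ i, stickWeight p.1 (I i) :=
    fun I => Finset.measurable_fun_prod _ fun i _ => (measurable_stickWeight _).comp measurable_fst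
  have hY : ∀ I : Fin n → ℕ, Measurable fun (p : (ℕ → ℝ) × (ℕ → V)) i => p.2 (I i) :=
    fun I => by fun_prop
  -- Boxes form a generating π-system. On a box the sampling law gives ∏ P(A_i), which expands into
  -- a sum over the tuples of atom indices.
  have hbox : ∀ A : Fin n → Set V, (∀ i, MeasurableSet (A i)) →
      μ.map (fun ω i => X i ω) (Set.univ.pi A) = Measure.sum (fun I : Fin n → ℕ =>
        ((atomLaw α θ ν).withDensity fun p => ∏ i, stickWeight p.1 (I i)).map
          fun p i => p.2 (I i)) (Set.univ.pi A) := by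
    intro A hA
    have hAm : MeasurableSet (Set.univ.pi A) := MeasurableSet.univ_pi hA
    have h1 := hX.2 Set.univ A MeasurableSet.univ hA
    have hq : Measurable fun q : Measure V => ∏ i, q (A i) :=
      Finset.measurable_fun_prod _ fun i _ => Measure.measurable_coe (hA i)
    simp only [Set.mem_univ, true_and, Set.ofPred_true, Measure.restrict_univ] at h1
    rw [hP.lintegral_comp (f := fun q => ∏ i, q (A i)) hq.aemeasurable, pypLaw_eq_map,
      lintegral_map hq measurable_stickBreaking] at h1
    rw [Measure.map_apply hXm hAm, Measure.sum_apply _ hAm]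
    have h2 : (fun ω i => X i ω) ⁻¹' Set.univ.pi A = {ω | ∀ i, X i ω ∈ A i} := by
      ext ω; simp
    rw [h2, h1]
    have hind : ∀ (I : Fin n → ℕ) (p : (ℕ → ℝ) × (ℕ → V)),
        ∏ i, stickWeight p.1 (I i) * (A i).indicator 1 (p.2 (I i)) =
          ((fun p i => p.2 (I i)) ⁻¹' Set.univ.pi A).indicator
            (fun p : (ℕ → ℝ) × (ℕ → V) => ∏ i, stickWeight p.1 (I i)) p := by
      intro I p
      classical
      rw [Finset.prod_mul_distrib, Set.indicator_apply]
      split_ifs with h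
      · have h' : ∀ i, p.2 (I i) ∈ A i := by simpa using h
        simp [Set.indicator_of_mem (h' _)]
      · have h' : ∃ i, p.2 (I i) ∉ A i := by simpa using h
        obtain ⟨i, hi⟩ := h'
        rw [Finset.prod_eq_zero (f := fun i => (A i).indicator (1 : V → ℝ≥0∞) (p.2 (I i)))
          (Finset.mem_univ i) (Set.indicator_of_notMem hi 1), mul_zero]
    calc ∫⁻ p, ∏ i, stickBreaking p (A i) ∂atomLaw α θ ν
        = ∫⁻ p, ∑' I : Fin n → ℕ, ((fun p i => p.2 (I i)) ⁻¹' Set.univ.pi A).indicator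
            (fun p : (ℕ → ℝ) × (ℕ → V) => ∏ i, stickWeight p.1 (I i)) p ∂atomLaw α θ ν := by
          refine lintegral_congr_ae ?_
          filter_upwards [ae_atomLaw_stick_le_one hα0 hα1 hθ] with p hp
          simp_rw [stickBreaking_apply hp (hA _), prod_tsum_eq_tsum_prod, hind]
      _ = ∑' I : Fin n → ℕ, ∫⁻ p, ((fun p i => p.2 (I i)) ⁻¹' Set.univ.pi A).indicator
            (fun p : (ℕ → ℝ) × (ℕ → V) => ∏ i, stickWeight p.1 (I i)) p ∂atomLaw α θ ν :=
          lintegral_tsum fun I => ((hd I).indicator (hY I hAm)).aemeasurable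
      _ = _ := by
          refine tsum_congr fun I => ?_
          rw [Measure.map_apply (hY I) hAm, withDensity_apply _ (hY I hAm),
            lintegral_indicator (hY I hAm)]
  have : IsProbabilityMeasure (μ.map fun ω i => X i ω) :=
    Measure.isProbabilityMeasure_map hXm.aemeasurable
  refine ext_of_generate_finite _ generateFrom_pi.symm (isPiSystem_pi) ?_ ?_
  · rintro _ ⟨A, hA, rfl⟩
    exact hbox A fun i => hA i (Set.mem_univ i)
  · rw [← Set.pi_univ Set.univ]
    exact hbox _ fun _ => MeasurableSet.univ

variable [IsProbabilityMeasure ν]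

/-- By Fubini the diagonal is null for `ν.prod ν`, as each of its sections is a singleton; there are
countably many pairs of indices. -/
theorem ae_infinitePi_injective [MeasurableEq V] [NullSingletonClass ν] :
    ∀ᵐ Y ∂Measure.infinitePi fun _ : ℕ => ν, Function.Injective Y := by
  have h : ∀ i j : ℕ, i ≠ j → ∀ᵐ Y ∂Measure.infinitePi fun _ : ℕ => ν, Y i ≠ Y j := by
    intro i j hij
    have hmap := Measure.infinitePi_map_eval_prod (P := fun _ : ℕ => ν) hij
    have hd : (ν.prod ν) (Set.diagonal V) = 0 := by
      rw [Measure.measure_prod_null measurableSet_diagonal]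
      refine Filter.Eventually.of_forall fun x => ?_
      have : Prod.mk x ⁻¹' Set.diagonal V = {x} := by
        ext y; simp [eq_comm]
      simp [this]
    rw [← hmap, Measure.map_apply (by fun_prop) measurableSet_diagonal] at hd
    exact measure_eq_zero_iff_ae_notMem.1 hd
  have h' : ∀ᵐ Y ∂Measure.infinitePi fun _ : ℕ => ν, ∀ i j : ℕ, i ≠ j → Y i ≠ Y j :=
    ae_all_iff.2 fun i => ae_all_iff.2 fun j => by
      by_cases hij : i = j
      · simp [hij]
      · exact (h i j hij).mono fun Y hY _ => hY
  filter_upwards [h'] with Y hY i j hij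
  by_contra hne
  exact hY i j hne hij

theorem measurableSet_ker_eq [MeasurableEq V] (s : Setoid (Fin n)) :
    MeasurableSet {x : Fin n → V | Setoid.ker x = s} := by
  have h : {x : Fin n → V | Setoid.ker x = s} = ⋂ i, ⋂ j, {x | x i = x j ↔ s i j} := by
    ext x
    simp only [Set.mem_ofPred_eq, Set.mem_iInter]
    exact ⟨fun h i j => by rw [← h]; rfl, fun h => Setoid.ext h⟩
  rw [h]
  refine MeasurableSet.iInter fun i => MeasurableSet.iInter fun j => ?_
  have hm : MeasurableSet {x : Fin n → V | x i = x j} :=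
    measurableSet_eq_fun (measurable_pi_apply i) (measurable_pi_apply j)
  by_cases hs : s i j
  · simpa [hs] using hm
  · have : {x : Fin n → V | x i = x j ↔ s i j} = {x | x i = x j}ᶜ := by
      ext x; simp [hs]
    exact this ▸ hm.compl

/-- The law of the random partition that is generated by a sample from a Pitman–Yor process. -/
theorem measure_ker_sample_eq [MeasurableEq V] [NullSingletonClass ν]
    (hα0 : 0 ≤ α) (hα1 : α < 1) (hθ : -α < θ)
    (hP : HasLaw P (pypLaw α θ ν) μ) (hX : IsSampleFrom μ X P) (s : Setoid (Fin n)) :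
    μ {ω | Setoid.ker (fun i => X i ω) = s} = ENNReal.ofReal (eppf α θ s) := by
  classical
  have hXm : Measurable fun ω i => X i ω := measurable_pi_lambda _ hX.1
  have hs := measurableSet_ker_eq (V := V) s
  have hSt := isProbabilityMeasure_stickLaw hα0 hα1 hθ
  have hw : ∀ I : Fin n → ℕ, Measurable fun v => ∏ i, stickWeight v (I i) :=
    fun I => Finset.measurable_fun_prod _ fun i _ => measurable_stickWeight _
  have hw' : ∀ I : Fin n → ℕ,
      Measurable fun v => if Setoid.ker I = s then ∏ i, stickWeight v (I i) else 0 := by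
    intro I
    split_ifs
    exacts [hw I, measurable_const]
  have h1 : μ {ω | Setoid.ker (fun i => X i ω) = s} =
      μ.map (fun ω i => X i ω) {x : Fin n → V | Setoid.ker x = s} := by
    rw [Measure.map_apply hXm hs]; rfl
  rw [h1, map_sample_eq_sum hα0 hα1 hθ hP hX, Measure.sum_apply _ hs,
    ← lintegral_tsum_prod_of_ker_eq hα0 hα1 hθ s, lintegral_tsum fun I => (hw' I).aemeasurable]
  refine tsum_congr fun I => ?_
  have hY : Measurable fun (p : (ℕ → ℝ) × (ℕ → V)) i => p.2 (I i) := by fun_prop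
  rw [Measure.map_apply hY hs, withDensity_apply _ (hY hs), ← lintegral_indicator (hY hs)]
  calc _ = ∫⁻ p, (if Setoid.ker I = s then ∏ i, stickWeight p.1 (I i) else 0) ∂atomLaw α θ ν := by
        refine lintegral_congr_ae ?_
        have hinj : ∀ᵐ p ∂atomLaw α θ ν, Function.Injective p.2 :=
          Measure.quasiMeasurePreserving_snd.ae ae_infinitePi_injective
        filter_upwards [hinj] with p hp
        have hk : Setoid.ker (fun i => p.2 (I i)) = Setoid.ker I :=
          Setoid.ext fun i j => hp.eq_iff
        simp only [Set.indicator_apply, Set.mem_preimage, Set.mem_ofPred_eq, hk]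
    _ = _ := by
        rw [atomLaw, lintegral_prod _ (by exact ((hw' I).comp measurable_fst).aemeasurable)]
        simp

end Sample

/-! ### Inclusion–exclusion -/

section InclusionExclusion

theorem sum_choose_mul_choose {M c : ℕ} (hc : c ≤ M) (a : ℕ → ℝ) :
    ∑ r ∈ Finset.range (M + 1), (M.choose r : ℝ) * ((-1) ^ (r - c) * r.choose c * a r) =
      M.choose c * ∑ i ∈ Finset.range (M - c + 1),
        ((M - c).choose i : ℝ) * (-1) ^ (M - c - i) * a (M - i) := by
  obtain ⟨d, rfl⟩ := Nat.exists_eq_add_of_le hc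
  rw [add_assoc, Finset.sum_range_add, Finset.sum_eq_zero, zero_add, Nat.add_sub_cancel_left,
    ← Finset.sum_range_reflect, Finset.mul_sum]
  · refine Finset.sum_congr rfl fun i hi => ?_
    have hi' : i ≤ d := by simpa [Nat.lt_succ_iff] using hi
    have h := Nat.choose_mul (n := c + d) (k := c + (d - i)) (s := c) (by omega)
    rw [Nat.add_sub_cancel_left, Nat.add_sub_cancel_left, Nat.choose_symm hi'] at h
    have h' : ((c + d).choose (c + (d - i)) : ℝ) * (c + (d - i)).choose c =
        (c + d).choose c * d.choose i := by exact_mod_cast h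
    rw [show d + 1 - 1 - i = d - i by omega, Nat.add_sub_cancel_left,
      show c + d - i = c + (d - i) by omega]
    linear_combination (-1) ^ (d - i) * a (c + (d - i)) * h'
  · intro r hr
    rw [Nat.choose_eq_zero_of_lt (Finset.mem_range.1 hr)]
    simp

/-- This is the pointwise form of inclusion–exclusion for exact cardinality. The truncated exponent
is harmless because `R.card.choose c` vanishes when `R.card < c`. -/
theorem sum_powerset_choose {ι : Type*} (Z : Finset ι) (c : ℕ) :
    ∑ R ∈ Z.powerset, ((-1) ^ (R.card - c) * (R.card.choose c : ℝ)) = if Z.card = c then 1 else 0 := by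
  rw [Finset.sum_powerset_apply_card fun r => (-1 : ℝ) ^ (r - c) * (r.choose c : ℝ)]
  simp only [nsmul_eq_mul]
  rcases lt_or_ge Z.card c with h | h
  · rw [if_neg h.ne]
    refine Finset.sum_eq_zero fun r hr => ?_
    rw [Nat.choose_eq_zero_of_lt (show r < c by have := Finset.mem_range.1 hr; omega)]
    simp
  · have h1 := sum_choose_mul_choose h fun _ => 1
    simp only [mul_one] at h1
    have h2 := add_pow (1 : ℝ) (-1) (Z.card - c)
    simp only [one_pow, one_mul, add_neg_cancel] at h2
    rw [h1, Finset.sum_congr rfl fun i _ => mul_comm _ _, ← h2]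
    split_ifs with hZ
    · simp [hZ]
    · rw [zero_pow (by omega), mul_zero]

variable {Ω : Type*} [MeasurableSpace Ω] {μ : Measure Ω} [IsFiniteMeasure μ]

theorem measurableSet_of_finset {ι : Type*} [Finite ι] {Z : Ω → Finset ι}
    (hZ : ∀ i, MeasurableSet {ω | i ∈ Z ω}) (p : Finset ι → Prop) :
    MeasurableSet {ω | p (Z ω)} := by
  have h : {ω | p (Z ω)} = ⋃ F ∈ {F | p F}, ⋂ i, {ω | i ∈ Z ω ↔ i ∈ F} := by
    ext ω
    simp only [Set.mem_ofPred_eq, Set.mem_iUnion, Set.mem_iInter, exists_prop]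
    exact ⟨fun H => ⟨Z ω, H, fun i => Iff.rfl⟩, fun ⟨F, hF, H⟩ => by rwa [Finset.ext H]⟩
  rw [h]
  refine MeasurableSet.biUnion (Set.to_countable _) fun F _ => MeasurableSet.iInter fun i => ?_
  by_cases hi : i ∈ F
  · simpa [hi] using hZ i
  · have : {ω | i ∈ Z ω ↔ i ∈ F} = {ω | i ∈ Z ω}ᶜ := by
      ext ω; simp [hi]
    exact this ▸ (hZ i).compl

/-- Inclusion–exclusion for the size of a random set `Z`, if the probability of `R ⊆ Z` depends only
on the size of `R`. -/
theorem measureReal_card_eq {ι : Type*} [Finite ι] {Z : Ω → Finset ι} {U : Finset ι}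
    (hZU : ∀ ω, Z ω ⊆ U) (hZ : ∀ i, MeasurableSet {ω | i ∈ Z ω}) {E : Set Ω} (hE : MeasurableSet E)
    {a : ℕ → ℝ} (ha : ∀ R ⊆ U, μ.real (E ∩ {ω | R ⊆ Z ω}) = a R.card) {c : ℕ} (hc : c ≤ U.card) :
    μ.real (E ∩ {ω | (Z ω).card = c}) =
      U.card.choose c * ∑ i ∈ Finset.range (U.card - c + 1),
        ((U.card - c).choose i : ℝ) * (-1) ^ (U.card - c - i) * a (U.card - i) := by
  classical
  have hm : ∀ p : Finset ι → Prop, MeasurableSet (E ∩ {ω | p (Z ω)}) := fun p =>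
    hE.inter (measurableSet_of_finset hZ p)
  have hpt : ∀ ω, (E ∩ {ω | (Z ω).card = c}).indicator (1 : Ω → ℝ) ω =
      ∑ R ∈ U.powerset, ((-1) ^ (R.card - c) * (R.card.choose c : ℝ)) *
        (E ∩ {ω | R ⊆ Z ω}).indicator (1 : Ω → ℝ) ω := by
    intro ω
    by_cases hω : ω ∈ E
    · have h := sum_powerset_choose (Z ω) c
      have hf : U.powerset.filter (· ⊆ Z ω) = (Z ω).powerset := by
        ext R
        simp only [Finset.mem_filter, Finset.mem_powerset]
        exact ⟨fun H => H.2, fun H => ⟨H.trans (hZU ω), H⟩⟩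
      rw [← hf, Finset.sum_filter] at h
      simp only [Set.indicator_apply, Set.mem_inter_iff, hω, true_and, Set.mem_ofPred_eq,
        Pi.one_apply, mul_ite, mul_one, mul_zero]
      exact h.symm
    · simp [Set.indicator, hω]
  rw [← sum_choose_mul_choose hc a]
  simp only [← nsmul_eq_mul (_ : ℕ) (_ : ℝ)]
  rw [← Finset.sum_powerset_apply_card fun r => (-1 : ℝ) ^ (r - c) * (r.choose c : ℝ) * a r,
    ← integral_indicator_one (hm fun F => F.card = c)]
  simp_rw [hpt]
  rw [integral_finsetSum _ fun R _ =>
    (by exact ((integrable_const (1 : ℝ)).indicator (hm fun F => R ⊆ F)).const_mul _)]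
  refine Finset.sum_congr rfl fun R hR => ?_
  rw [integral_const_mul, integral_indicator_one (hm fun F => R ⊆ F),
    ha R (Finset.mem_powerset.1 hR)]

theorem measureReal_eq_sum_fiber {σ : Type*} [Fintype σ] {g : Ω → σ}
    (hg : ∀ s, MeasurableSet {ω | g ω = s}) {E : Set Ω} (hE : MeasurableSet E) :
    μ.real E = ∑ s, μ.real ({ω | g ω = s} ∩ E) := by
  rw [← measureReal_biUnion_finset]
  · congr 1
    ext ω
    simp
  · intro s _ t _ hst
    exact Set.disjoint_left.2 fun ω h1 h2 => hst (h1.1.symm.trans h2.1)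
  · exact fun s _ => (hg s).inter hE

end InclusionExclusion

/-! ### Collisions of hash values given the partition -/

section Hash

variable {Ω V : Type*} [MeasurableSpace Ω] [MeasurableSpace V] [MeasurableEq V]
  {μ : Measure Ω} {n J : ℕ} {X : Fin n → Ω → V} {h : Ω → V → Fin J}

/-- The number of blocks of a partition which meet a given set. -/
noncomputable def numBlocksOn {ι : Type} (s : Setoid ι) (T : Set ι) : ℕ :=
  ((fun i => (⟦i⟧ : Quotient s)) '' T).ncard

theorem numBlocks_comap {ι κ : Type} (s : Setoid ι) (f : κ → ι) :
    numBlocks (s.comap f) = numBlocksOn s (Set.range f) := by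
  rw [Setoid.comap_eq, numBlocks_ker, numBlocksOn, Set.range_comp]

/-- The probability that a sample generates the partition `s` and that the points with indices
in `T` are all hashed to the same bucket. -/
theorem measure_ker_inter_same_bucket (hX : ∀ i, Measurable (X i))
    (hh : IsPerfectlyRandomHash μ (fun ω i => X i ω) h) (s : Setoid (Fin n)) {T : Set (Fin n)}
    {a : Fin n} (ha : a ∈ T) :
    μ ({ω | Setoid.ker (fun i => X i ω) = s} ∩ {ω | ∀ i ∈ T, h ω (X i ω) = h ω (X a ω)}) =
      μ {ω | Setoid.ker (fun i => X i ω) = s} * (J * (J : ℝ≥0∞)⁻¹ ^ numBlocksOn s T) := by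
  set t : Setoid T := s.comap Subtype.val with ht
  have hK : numBlocksOn s T = Nat.card (Quotient t) := by
    have := numBlocks_comap s (Subtype.val : T → Fin n)
    rw [Subtype.range_coe] at this
    exact this.symm
  have hXm : Measurable fun ω i => X i ω := measurable_pi_lambda _ hX
  have hhX : ∀ i, Measurable fun ω => h ω (X i ω) := fun i =>
    hh.1 (fun x => x i) (measurable_pi_apply i)
  have hs : MeasurableSet {ω | Setoid.ker (fun i => X i ω) = s} := hXm (measurableSet_ker_eq s)
  -- For a prescribed common bucket, the tokens are one representative for each block that meets
  -- `T`. They are distinct on the event that the partition is `s`, so the hash assumption applies;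
  -- summing over buckets gives the factor J.
  have hj : ∀ j : Fin J,
      μ ({ω | Setoid.ker (fun i => X i ω) = s} ∩ {ω | ∀ i ∈ T, h ω (X i ω) = j}) =
        μ {ω | Setoid.ker (fun i => X i ω) = s} * (J : ℝ≥0∞)⁻¹ ^ numBlocksOn s T := by
    intro j
    have σ : Quotient t ≃ Fin (Nat.card (Quotient t)) := Finite.equivFin _
    have key := hh.2 (Nat.card (Quotient t)) (fun b x => x (σ.symm b).out.1)
      {x | Setoid.ker x = s} (fun b => measurable_pi_apply _) (measurableSet_ker_eq s)
      (fun x hx b b' hbb => by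
        have hx' : Setoid.ker x = s := hx
        have h1 : s (σ.symm b).out.1 (σ.symm b').out.1 := by rw [← hx']; exact hbb
        have h2 : (σ.symm b).out ≈ (σ.symm b').out := h1
        exact σ.symm.injective (Quotient.out_equiv_out.1 h2)) fun _ => j
    rw [hK]
    refine Eq.trans ?_ key
    congr 1
    ext ω
    refine and_congr_right fun hω => ⟨fun H b => H _ (σ.symm b).out.2, fun H i hi => ?_⟩
    have hω' : Setoid.ker (fun i => X i ω) = s := hω
    have h1 : t (⟦(⟨i, hi⟩ : T)⟧ : Quotient t).out ⟨i, hi⟩ := Quotient.mk_out _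
    have h2 : s (⟦(⟨i, hi⟩ : T)⟧ : Quotient t).out.1 i := h1
    rw [← hω'] at h2
    have h3 := H (σ ⟦(⟨i, hi⟩ : T)⟧)
    rw [σ.symm_apply_apply] at h3
    have h4 : X (⟦(⟨i, hi⟩ : T)⟧ : Quotient t).out.1 ω = X i ω := h2
    rwa [← h4]
  have hU : {ω | Setoid.ker (fun i => X i ω) = s} ∩ {ω | ∀ i ∈ T, h ω (X i ω) = h ω (X a ω)} =
      ⋃ j : Fin J, {ω | Setoid.ker (fun i => X i ω) = s} ∩ {ω | ∀ i ∈ T, h ω (X i ω) = j} := by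
    rw [← Set.inter_iUnion]
    congr 1
    ext ω
    simp only [Set.mem_ofPred_eq, Set.mem_iUnion]
    exact ⟨fun H => ⟨_, H⟩, fun ⟨j, H⟩ i hi => (H i hi).trans (H a ha).symm⟩
  rw [hU, measure_iUnion, tsum_fintype, Finset.sum_congr rfl fun j _ => hj j]
  · simp only [Finset.sum_const, Finset.card_univ, Fintype.card_fin, nsmul_eq_mul]
    ring
  · intro j j' hjj
    exact Set.disjoint_left.2 fun ω h1 h2 => hjj ((h1.2 a ha).symm.trans (h2.2 a ha))
  · intro j
    have : {ω | ∀ i ∈ T, h ω (X i ω) = j} = ⋂ i ∈ T, {ω | h ω (X i ω) = j} := by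
      ext ω; simp
    rw [this]
    exact hs.inter (MeasurableSet.biInter (Set.to_countable _) fun i _ =>
      hhX i (measurableSet_singleton j))

end Hash

/-! ### Bucket-sharing probabilities as generating functions at 1/J -/

section Buckets

theorem measurableSet_same_bucket {V Ω : Type*} [MeasurableSpace Ω] [MeasurableSpace V]
    {μ : Measure Ω} {n J : ℕ} {X : Fin n → Ω → V} {h : Ω → V → Fin J}
    (hh : IsPerfectlyRandomHash μ (fun ω i => X i ω) h) (i a : Fin n) :
    MeasurableSet {ω | h ω (X i ω) = h ω (X a ω)} :=
  measurableSet_eq_fun (hh.1 (fun x => x i) (measurable_pi_apply i))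
    (hh.1 (fun x => x a) (measurable_pi_apply a))

variable {Ω V : Type*} [MeasurableSpace Ω] [MeasurableSpace V] [MeasurableEq V]
  {μ : Measure Ω} [IsProbabilityMeasure μ] {ν : Measure V} [IsProbabilityMeasure ν]
  [NullSingletonClass ν] {α θ : ℝ} {n J : ℕ} {P : Ω → Measure V} {X : Fin n → Ω → V}
  {h : Ω → V → Fin J}

theorem eppf_nonneg (hα0 : 0 ≤ α) (hα1 : α < 1) (hθ : -α < θ) {ι : Type} [Finite ι]
    (s : Setoid ι) : 0 ≤ eppf α θ s := by
  have := Fintype.ofFinite (Quotient s)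
  rw [eppf, blockProd, finprod_eq_prod_of_fintype]
  exact mul_nonneg (partitionWeight_nonneg hα0 hα1 hθ _ _)
    (Finset.prod_nonneg fun q _ => (rising_pos (by linarith) _).le)

theorem measureReal_ker_sample_eq (hα0 : 0 ≤ α) (hα1 : α < 1) (hθ : -α < θ)
    (hP : HasLaw P (pypLaw α θ ν) μ) (hX : IsSampleFrom μ X P) (s : Setoid (Fin n)) :
    μ.real {ω | Setoid.ker (fun i => X i ω) = s} = eppf α θ s := by
  rw [measureReal_def, measure_ker_sample_eq hα0 hα1 hθ hP hX,
    ENNReal.toReal_ofReal (eppf_nonneg hα0 hα1 hθ s)]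

theorem measurableSet_sample_ker_eq (hX : ∀ i, Measurable (X i)) (s : Setoid (Fin n)) :
    MeasurableSet {ω | Setoid.ker (fun i => X i ω) = s} :=
  measurable_pi_lambda _ hX (measurableSet_ker_eq s)

theorem measurableSet_sample_block_eq (hX : ∀ i, Measurable (X i)) (a : Fin n) (B : Set (Fin n)) :
    MeasurableSet {ω | ∀ i, X i ω = X a ω ↔ i ∈ B} := by
  rw [Set.ofPred_forall]
  refine MeasurableSet.iInter fun i => ?_
  have hm : MeasurableSet {ω | X i ω = X a ω} := measurableSet_eq_fun (hX i) (hX a)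
  by_cases hi : i ∈ B
  · simpa [hi] using hm
  · have : {ω | X i ω = X a ω ↔ i ∈ B} = {ω | X i ω = X a ω}ᶜ := by
      ext ω; simp [hi]
    exact this ▸ hm.compl

theorem measureReal_ker_inter_same_bucket (hα0 : 0 ≤ α) (hα1 : α < 1) (hθ : -α < θ)
    (hP : HasLaw P (pypLaw α θ ν) μ) (hX : IsSampleFrom μ X P)
    (hh : IsPerfectlyRandomHash μ (fun ω i => X i ω) h) (s : Setoid (Fin n)) {T : Set (Fin n)}
    {a : Fin n} (ha : a ∈ T) :
    μ.real ({ω | Setoid.ker (fun i => X i ω) = s} ∩ {ω | ∀ i ∈ T, h ω (X i ω) = h ω (X a ω)}) =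
      eppf α θ s * (J * (1 / J) ^ numBlocksOn s T) := by
  rw [measureReal_def, measure_ker_inter_same_bucket hX.1 hh s ha, ENNReal.toReal_mul,
    ← measureReal_def, measureReal_ker_sample_eq hα0 hα1 hθ hP hX, ENNReal.toReal_mul,
    ENNReal.toReal_pow, ENNReal.toReal_inv, ENNReal.toReal_natCast, one_div]

/-- The probability that a given set of points of the sample is hashed to a single bucket. -/
theorem measureReal_same_bucket (hα0 : 0 ≤ α) (hα1 : α < 1) (hθ : -α < θ)
    (hP : HasLaw P (pypLaw α θ ν) μ) (hX : IsSampleFrom μ X P)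
    (hh : IsPerfectlyRandomHash μ (fun ω i => X i ω) h) {T : Set (Fin n)} {a : Fin n}
    (ha : a ∈ T) :
    μ.real {ω | ∀ i ∈ T, h ω (X i ω) = h ω (X a ω)} =
      J * distinctPGF T.ncard (1 / J) α θ := by
  have hE : MeasurableSet {ω | ∀ i ∈ T, h ω (X i ω) = h ω (X a ω)} := by
    have : {ω | ∀ i ∈ T, h ω (X i ω) = h ω (X a ω)} =
        ⋂ i ∈ T, {ω | h ω (X i ω) = h ω (X a ω)} := by
      ext ω; simp
    rw [this]
    exact MeasurableSet.biInter (Set.to_countable _) fun i _ => measurableSet_same_bucket hh i a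
  rw [measureReal_eq_sum_fiber (measurableSet_sample_ker_eq hX.1) hE]
  have hK : ∀ s : Setoid (Fin n), numBlocksOn s T = numBlocks (s.comap (Subtype.val : T → Fin n)) :=
    fun s => by rw [numBlocks_comap, Subtype.range_coe]
  simp_rw [measureReal_ker_inter_same_bucket hα0 hα1 hθ hP hX hh _ ha, hK]
  rw [← Nat.card_coe_set_eq, ← sum_eppf_mul_pow_numBlocks hα0 hα1 hθ,
    ← sum_eppf_comap (by linarith) (Subtype.val : T → Fin n) Subtype.val_injective
      fun t => (1 / (J : ℝ)) ^ numBlocks t, Finset.mul_sum]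
  exact Finset.sum_congr rfl fun s _ => by ring

theorem numBlocksOn_insert {ι : Type} [Finite ι] {s : Setoid ι} {a : ι} {R : Set ι}
    (hR : ∀ i ∈ R, ¬ s i a) : numBlocksOn s (insert a R) = numBlocksOn s R + 1 := by
  have : Finite (Quotient s) := Quotient.finite s
  rw [numBlocksOn, Set.image_insert_eq, Set.ncard_insert_of_notMem _ (Set.toFinite _), numBlocksOn]
  rintro ⟨i, hi, hia⟩
  exact hR i hi (Quotient.eq.1 hia)

/-- The probability that the points of the sample which are equal to a given one are those
with indices in `B`, and that a given set of further points is hashed to the same bucket. -/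
theorem measureReal_block_inter_same_bucket (hα0 : 0 ≤ α) (hα1 : α < 1) (hθ : -α < θ)
    (hJ : 0 < J) (hP : HasLaw P (pypLaw α θ ν) μ) (hX : IsSampleFrom μ X P)
    (hh : IsPerfectlyRandomHash μ (fun ω i => X i ω) h) {B R : Set (Fin n)} {a : Fin n}
    (ha : a ∈ B) (hR : Disjoint R B) :
    μ.real ({ω | ∀ i, X i ω = X a ω ↔ i ∈ B} ∩ {ω | ∀ i ∈ R, h ω (X i ω) = h ω (X a ω)}) =
      rising (1 - α) (B.ncard - 1) * rising (θ + α) (n - B.ncard) / rising (θ + 1) (n - 1) *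
        distinctPGF R.ncard (1 / J) α (θ + α) := by
  classical
  have hRB : ∀ x : R, x.1 ∉ B := fun x => Set.disjoint_left.1 hR x.2
  set g : R → {x // x ∉ B} := fun x => ⟨x.1, hRB x⟩ with hg
  have hgi : Function.Injective g := fun x y hxy =>
    Subtype.ext (congr_arg (fun z : {x // x ∉ B} => z.1) hxy)
  have hE : MeasurableSet {ω | ∀ i ∈ R, h ω (X i ω) = h ω (X a ω)} := by
    have : {ω | ∀ i ∈ R, h ω (X i ω) = h ω (X a ω)} =
        ⋂ i ∈ R, {ω | h ω (X i ω) = h ω (X a ω)} := by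
      ext ω; simp
    rw [this]
    exact MeasurableSet.biInter (Set.to_countable _) fun i _ => measurableSet_same_bucket hh i a
  have hJ' : (J : ℝ) ≠ 0 := by positivity
  have hterm : ∀ s : Setoid (Fin n),
      μ.real ({ω | Setoid.ker (fun i => X i ω) = s} ∩ ({ω | ∀ i, X i ω = X a ω ↔ i ∈ B} ∩
        {ω | ∀ i ∈ R, h ω (X i ω) = h ω (X a ω)})) =
      if ∀ x, s x a ↔ x ∈ B then
        eppf α θ s * (1 / (J : ℝ)) ^ numBlocks ((s.comap Subtype.val).comap g) else 0 := by
    intro s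
    split_ifs with hs
    · have hset : {ω | Setoid.ker (fun i => X i ω) = s} ∩ ({ω | ∀ i, X i ω = X a ω ↔ i ∈ B} ∩
          {ω | ∀ i ∈ R, h ω (X i ω) = h ω (X a ω)}) =
          {ω | Setoid.ker (fun i => X i ω) = s} ∩
            {ω | ∀ i ∈ insert a R, h ω (X i ω) = h ω (X a ω)} := by
        ext ω
        simp only [Set.mem_inter_iff, Set.mem_ofPred_eq, Set.forall_mem_insert, true_and]
        refine and_congr_right fun hω => and_iff_right ?_
        intro i
        rw [← hs i, ← hω]
        rfl
      -- The block of `a` is disjoint from `R` and counts once more; its factor 1/J cancels the J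
      -- choices of the common bucket.
      have hK : numBlocksOn s (insert a R) = numBlocks ((s.comap Subtype.val).comap g) + 1 := by
        rw [numBlocksOn_insert fun i hi hia => Set.disjoint_left.1 hR hi ((hs i).1 hia),
          ← Setoid.comap_comp, numBlocks_comap]
        congr 2
        exact Subtype.range_coe.symm
      rw [hset, measureReal_ker_inter_same_bucket hα0 hα1 hθ hP hX hh s (Set.mem_insert a R), hK,
        pow_succ', ← mul_assoc (J : ℝ), mul_one_div_cancel hJ', one_mul]
    · convert measureReal_empty
      ext ω
      simp only [Set.mem_inter_iff, Set.mem_ofPred_eq, Set.mem_empty_iff_false, iff_false]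
      rintro ⟨rfl, h1, -⟩
      exact hs h1
  rw [measureReal_eq_sum_fiber (measurableSet_sample_ker_eq hX.1)
    ((measurableSet_sample_block_eq hX.1 a B).inter hE), Finset.sum_congr rfl fun s _ => hterm s,
    sum_eppf_of_block hθ ha fun t => (1 / (J : ℝ)) ^ numBlocks (t.comap g),
    sum_eppf_comap (by linarith) g hgi fun t => (1 / (J : ℝ)) ^ numBlocks t,
    sum_eppf_mul_pow_numBlocks hα0 hα1 (by linarith), Nat.card_fin, Nat.card_coe_set_eq]

end Buckets

/-! ### Counts that include the last observation -/

section Counts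

/-- Both branches of the definition are the same expression once the factor θ is cancelled. -/
theorem thetaFactor_eq {θ : ℝ} (m : ℕ) : thetaFactor θ m = 1 / rising (θ + 1) m := by
  rw [thetaFactor]
  split_ifs with h
  · rw [h, zero_add]
  · rw [rising_succ_left, div_mul_eq_div_div, div_self h]

theorem sum_indicator_castSucc_add_one {E : Type*} {m : ℕ} (y : Fin (m + 1) → E)
    [DecidablePred fun i => y i = y (Fin.last m)] :
    ∑ i : Fin m, Set.indicator {y i.castSucc} (fun _ => 1) (y (Fin.last m)) + 1 =
      (Finset.univ.filter fun i => y i = y (Fin.last m)).card := by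
  classical
  rw [Finset.card_filter, Fin.sum_univ_castSucc, if_pos rfl]
  congr 1
  refine Finset.sum_congr rfl fun i _ => ?_
  simp [Set.indicator_apply, eq_comm]

theorem freq_add_one {V : Type*} {m : ℕ} (x : Fin (m + 1) → V)
    [DecidablePred fun i => x i = x (Fin.last m)] :
    freq (fun i : Fin m => x i.castSucc) (x (Fin.last m)) + 1 =
      (Finset.univ.filter fun i => x i = x (Fin.last m)).card :=
  sum_indicator_castSucc_add_one x

theorem bucketCount_add_one {V : Type*} {m J : ℕ} (h : V → Fin J) (x : Fin (m + 1) → V) :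
    bucketCount h (fun i : Fin m => x i.castSucc) (x (Fin.last m)) + 1 =
      (Finset.univ.filter fun i => h (x i) = h (x (Fin.last m))).card :=
  sum_indicator_castSucc_add_one fun i => h (x i)

end Counts

/-! ### Marginal and joint laws of the counts -/

section JointLaw

variable {Ω V : Type*} [MeasurableSpace Ω] [MeasurableSpace V] [MeasurableEq V]
  {μ : Measure Ω} [IsProbabilityMeasure μ] {ν : Measure V} [IsProbabilityMeasure ν]
  [NullSingletonClass ν] {α θ : ℝ} {m J : ℕ} {P : Ω → Measure V} {X : Fin (m + 1) → Ω → V}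
  {h : Ω → V → Fin J}

/-- The law of the number of distinct values in a sample from a Pitman–Yor process. -/
theorem measureReal_ncard_range_eq (hα0 : 0 ≤ α) (hα1 : α < 1) (hθ : -α < θ)
    (hP : HasLaw P (pypLaw α θ ν) μ) (hX : IsSampleFrom μ X P) (k : ℕ) :
    μ.real {ω | (Set.range fun i => X i ω).ncard = k} = distinctPMF α θ (m + 1) k := by
  have hset : {ω | (Set.range fun i => X i ω).ncard = k} =
      ⋃ s ∈ {s : Setoid (Fin (m + 1)) | numBlocks s = k},
        {ω | Setoid.ker (fun i => X i ω) = s} := by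
    ext ω
    simp only [Set.mem_ofPred_eq, Set.mem_iUnion, exists_prop]
    rw [← numBlocks_ker]
    exact ⟨fun H => ⟨_, H, rfl⟩, fun ⟨s, H, hs⟩ => hs ▸ H⟩
  have hE : MeasurableSet {ω | (Set.range fun i => X i ω).ncard = k} := by
    rw [hset]
    exact MeasurableSet.biUnion (Set.to_countable _) fun s _ =>
      measurableSet_sample_ker_eq hX.1 s
  rw [measureReal_eq_sum_fiber (measurableSet_sample_ker_eq hX.1) hE]
  have hsum := sum_eppf_of_numBlocks hα0 hα1 hθ (Fin (m + 1)) k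
  rw [Nat.card_fin] at hsum
  rw [← hsum]
  refine Finset.sum_congr rfl fun s _ => ?_
  rw [← measureReal_ker_sample_eq hα0 hα1 hθ hP hX s]
  split_ifs with hs
  · congr 1
    refine Set.inter_eq_left.2 fun ω hω => ?_
    rw [Set.mem_ofPred_eq, ← numBlocks_ker, ← hs]
    exact congr_arg numBlocks hω
  · convert measureReal_empty
    ext ω
    simp only [Set.mem_inter_iff, Set.mem_ofPred_eq, Set.mem_empty_iff_false, iff_false]
    rintro ⟨rfl, h1⟩
    exact hs ((numBlocks_ker _).trans h1)

/-- The law of the size of the bucket of the last observation. -/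
theorem measureReal_bucketCount_eq (hα0 : 0 ≤ α) (hα1 : α < 1) (hθ : -α < θ)
    (hP : HasLaw P (pypLaw α θ ν) μ) (hX : IsSampleFrom μ X P)
    (hh : IsPerfectlyRandomHash μ (fun ω i => X i ω) h) {c : ℕ} (hc : c ≤ m) :
    μ.real {ω | bucketCount (h ω) (fun i : Fin m => X i.castSucc ω) (X (Fin.last m) ω) = c} =
      m.choose c * ∑ i ∈ Finset.range (m - c + 1), ((m - c).choose i : ℝ) * (-1) ^ (m - c - i) *
        (J * distinctPGF (m - i + 1) (1 / J) α θ) := by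
  set U : Finset (Fin (m + 1)) := Finset.univ.erase (Fin.last m) with hU
  set Z : Ω → Finset (Fin (m + 1)) := fun ω =>
    U.filter fun i => h ω (X i ω) = h ω (X (Fin.last m) ω) with hZ
  have hUc : U.card = m := by simp [hU]
  have hZm : ∀ i, MeasurableSet {ω | i ∈ Z ω} := fun i => by
    have : {ω | i ∈ Z ω} = {ω | i ∈ U} ∩ {ω | h ω (X i ω) = h ω (X (Fin.last m) ω)} := by
      ext ω; simp [hZ]
    rw [this]
    exact (MeasurableSet.const _).inter (measurableSet_same_bucket hh i _)
  -- A set `R` of earlier indices lies in the bucket of the last observation when the |R| + 1 points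
  -- of `R` and the last index collide, whence the index r + 1.
  have key := measureReal_card_eq (μ := μ) (Z := Z) (U := U) (E := Set.univ) (c := c)
    (a := fun r => J * distinctPGF (r + 1) (1 / J) α θ) (fun ω => Finset.filter_subset _ _) hZm
    MeasurableSet.univ (fun R hR => by
      have hl : Fin.last m ∉ R := fun hl => by simpa [hU] using hR hl
      have hcard : (insert (Fin.last m) (R : Set (Fin (m + 1)))).ncard = R.card + 1 := by
        rw [Set.ncard_insert_of_notMem (by simpa using hl) (Set.toFinite _),
          Set.ncard_coe_finset]
      rw [← hcard, ← measureReal_same_bucket hα0 hα1 hθ hP hX hh (Set.mem_insert _ _),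
        Set.univ_inter]
      congr 1
      ext ω
      simp only [Set.mem_ofPred_eq, Set.forall_mem_insert, true_and, Finset.mem_coe]
      exact ⟨fun H i hi => (Finset.mem_filter.1 (H hi)).2,
        fun H i hi => Finset.mem_filter.2 ⟨hR hi, H i hi⟩⟩) (by rw [hUc]; exact hc)
  rw [hUc, Set.univ_inter] at key
  rw [← key]
  congr 1
  ext ω
  have h1 := bucketCount_add_one (h ω) fun i => X i ω
  have h2 : Z ω = (Finset.univ.filter fun i =>
      h ω (X i ω) = h ω (X (Fin.last m) ω)).erase (Fin.last m) := by
    ext i; simp [hZ, hU]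
  rw [Set.mem_ofPred_eq, Set.mem_ofPred_eq, h2, Finset.card_erase_of_mem (by simp), ← h1,
    Nat.add_sub_cancel]

/-- The joint law of the frequency of the last observation and of the size of its bucket. -/
theorem measureReal_freq_bucketCount_eq (hα0 : 0 ≤ α) (hα1 : α < 1) (hθ : -α < θ) (hJ : 0 < J)
    (hP : HasLaw P (pypLaw α θ ν) μ) (hX : IsSampleFrom μ X P)
    (hh : IsPerfectlyRandomHash μ (fun ω i => X i ω) h) {c l : ℕ} (hc : c ≤ m) (hl : l ≤ c) :
    μ.real ({ω | bucketCount (h ω) (fun i : Fin m => X i.castSucc ω) (X (Fin.last m) ω) = c} ∩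
        {ω | freq (fun i : Fin m => X i.castSucc ω) (X (Fin.last m) ω) = l}) =
      m.choose l * ((m - l).choose (c - l) * ∑ i ∈ Finset.range (m - c + 1),
        ((m - c).choose i : ℝ) * (-1) ^ (m - c - i) *
          (rising (1 - α) l * rising (θ + α) (m - l) / rising (θ + 1) m *
            distinctPGF (m - l - i) (1 / J) α (θ + α))) := by
  classical
  -- `D` lists the possible sets of the l earlier indices that carry the last token. For each of
  -- them inclusion–exclusion runs over the other m - l indices, c - l of which must fall in the
  -- bucket.
  set D := Finset.powersetCard l (Finset.univ.erase (Fin.last m)) with hD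
  have hDc : D.card = m.choose l := by simp [hD]
  have hB : ∀ F ∈ D, (insert (Fin.last m) F).card = l + 1 := fun F hF => by
    rw [Finset.mem_powersetCard] at hF
    rw [Finset.card_insert_of_notMem (fun hl => by simpa using hF.1 hl), hF.2]
  set Z : Finset (Fin (m + 1)) → Ω → Finset (Fin (m + 1)) := fun F ω =>
    (insert (Fin.last m) F)ᶜ.filter fun i => h ω (X i ω) = h ω (X (Fin.last m) ω) with hZ
  set E : Finset (Fin (m + 1)) → Set Ω := fun F =>
    {ω | ∀ i, X i ω = X (Fin.last m) ω ↔ i ∈ (insert (Fin.last m) F : Finset _)} with hE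
  have hEm : ∀ F, MeasurableSet (E F) := fun F =>
    measurableSet_sample_block_eq hX.1 _ ((insert (Fin.last m) F : Finset _) : Set (Fin (m + 1)))
  have hZm : ∀ F i, MeasurableSet {ω | i ∈ Z F ω} := fun F i => by
    have : {ω | i ∈ Z F ω} = {ω | i ∈ (insert (Fin.last m) F)ᶜ} ∩
        {ω | h ω (X i ω) = h ω (X (Fin.last m) ω)} := by
      ext ω; simp [hZ]
    rw [this]
    exact (MeasurableSet.const _).inter (measurableSet_same_bucket hh i _)
  have hlast : ∀ F ∈ D, Fin.last m ∉ F := fun F hF hl => by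
    simpa using (Finset.mem_powersetCard.1 hF).1 hl
  set S : Ω → Finset (Fin (m + 1)) := fun ω =>
    Finset.univ.filter fun i => X i ω = X (Fin.last m) ω with hS
  set T : Ω → Finset (Fin (m + 1)) := fun ω =>
    Finset.univ.filter fun i => h ω (X i ω) = h ω (X (Fin.last m) ω) with hT
  have hST : ∀ ω, S ω ⊆ T ω := fun ω i hi => by
    simp only [hS, hT, Finset.mem_filter, Finset.mem_univ, true_and] at hi ⊢
    rw [hi]
  have hES : ∀ F ω, ω ∈ E F ↔ S ω = insert (Fin.last m) F := fun F ω => by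
    simp [hE, hS, Finset.ext_iff]
  -- Equal tokens have equal hashes, so the bucket `T` consists of the block `S` and of the
  -- colliding indices outside it.
  have hZc : ∀ F ω, S ω = insert (Fin.last m) F → (Z F ω).card = (T ω).card - (S ω).card :=
    fun F ω hω => by
      rw [← Finset.card_sdiff_of_subset (hST ω)]
      congr 1
      ext i
      simp only [hZ, ← hω, Finset.mem_filter, Finset.mem_compl, Finset.mem_sdiff, hT,
        Finset.mem_univ, true_and]
      exact and_comm
  have hset : {ω | bucketCount (h ω) (fun i : Fin m => X i.castSucc ω) (X (Fin.last m) ω) = c} ∩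
        {ω | freq (fun i : Fin m => X i.castSucc ω) (X (Fin.last m) ω) = l} =
      ⋃ F ∈ D, E F ∩ {ω | (Z F ω).card = c - l} := by
    ext ω
    have h1 : _ = (T ω).card := bucketCount_add_one (h ω) fun i => X i ω
    have h2 : _ = (S ω).card := freq_add_one fun i => X i ω
    have h3 := Finset.card_le_card (hST ω)
    simp only [Set.mem_inter_iff, Set.mem_ofPred_eq, Set.mem_iUnion, exists_prop]
    constructor
    · rintro ⟨hc', hl'⟩
      have hmem : Fin.last m ∈ S ω := by simp [hS]
      have hins := Finset.insert_erase hmem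
      refine ⟨(S ω).erase (Fin.last m), ?_, (hES _ _).2 hins.symm, ?_⟩
      · rw [Finset.mem_powersetCard, Finset.card_erase_of_mem hmem]
        exact ⟨Finset.erase_subset_erase _ (Finset.subset_univ _), by omega⟩
      · rw [hZc _ _ hins.symm]
        omega
    · rintro ⟨F, hF, hω, hcard⟩
      have hω' := (hES _ _).1 hω
      have h4 := hB F hF
      rw [← hω'] at h4
      rw [hZc _ _ hω'] at hcard
      omega
  rw [hset, measureReal_biUnion_finset]
  rotate_left
  · intro F hF F' hF' hne
    refine Set.disjoint_left.2 fun ω h1 h2 => hne ?_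
    rw [← Finset.erase_insert (hlast F hF), ← Finset.erase_insert (hlast F' hF'),
      ← (hES F ω).1 h1.1, ← (hES F' ω).1 h2.1]
  · exact fun F _ => (hEm F).inter (measurableSet_of_finset (hZm F) fun G => G.card = c - l)
  rw [← hDc, ← nsmul_eq_mul, ← Finset.sum_const]
  refine Finset.sum_congr rfl fun F hF => ?_
  have hUc : (insert (Fin.last m) F)ᶜ.card = m - l := by
    rw [Finset.card_compl, hB F hF, Fintype.card_fin]
    omega
  have key := measureReal_card_eq (μ := μ) (Z := Z F) (U := (insert (Fin.last m) F)ᶜ) (E := E F)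
    (c := c - l) (a := fun r => rising (1 - α) l * rising (θ + α) (m - l) / rising (θ + 1) m *
            distinctPGF r (1 / J) α (θ + α)) (fun ω => Finset.filter_subset _ _) (hZm F) (hEm F)
    (fun R hR => by
      have hd : Disjoint (R : Set (Fin (m + 1))) ((insert (Fin.last m) F : Finset _) : Set _) := by
        rw [Finset.disjoint_coe]
        exact Finset.subset_compl_iff_disjoint_right.1 hR
      have h1 := measureReal_block_inter_same_bucket hα0 hα1 hθ hJ hP hX hh
        (Finset.mem_coe.2 (Finset.mem_insert_self (Fin.last m) F)) hd
      rw [Set.ncard_coe_finset, Set.ncard_coe_finset, hB F hF, Nat.add_sub_cancel,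
        Nat.add_sub_cancel, Nat.add_sub_add_right] at h1
      rw [← h1]
      congr 2
      ext ω
      simp only [Set.mem_ofPred_eq, Finset.mem_coe]
      exact ⟨fun H i hi => (Finset.mem_filter.1 (H hi)).2,
        fun H i hi => Finset.mem_filter.2 ⟨hR hi, H i hi⟩⟩) (by rw [hUc]; omega)
  rw [hUc, show m - l - (c - l) = m - c by omega] at key
  exact key

end JointLaw
end PYPSketch

/-! ### The conditional law of the frequency -/

theorem theorem2 {Ω V : Type*} [MeasurableSpace Ω] [MeasurableSpace V] [MeasurableEq V]
    (μ : Measure Ω) [IsProbabilityMeasure μ] (ν : Measure V) [IsProbabilityMeasure ν] [NullSingletonClass ν]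
    (α θ : ℝ) (hα0 : 0 ≤ α) (hα1 : α < 1) (hθ : -α < θ)
    (m J : ℕ) (hJ : 0 < J)
    (P : Ω → Measure V) (hP : HasLaw P (PYPSketch.pypLaw α θ ν) μ)
    (X : Fin (m + 1) → Ω → V) (hX : PYPSketch.IsSampleFrom μ X P)
    (h : Ω → V → Fin J) (hh : PYPSketch.IsPerfectlyRandomHash μ (fun ω i => X i ω) h)
    (f C : Ω → ℕ)
    (hf : ∀ ω, f ω = PYPSketch.freq (fun i : Fin m => X i.castSucc ω) (X (Fin.last m) ω))
    (hC : ∀ ω, C ω =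
      PYPSketch.bucketCount (h ω) (fun i : Fin m => X i.castSucc ω) (X (Fin.last m) ω)) :
    (∀ k : ℕ, μ.real {ω | (Set.range fun i => X i ω).ncard = k} =
      PYPSketch.distinctPMF α θ (m + 1) k) ∧
    ∀ c : ℕ, μ {ω | C ω = c} ≠ 0 →
      (∑ i ∈ Finset.range (m - c + 1), ((m - c).choose i : ℝ) * (-1) ^ (m - c - i) *
          PYPSketch.distinctPGF (m - i + 1) (1 / J) α θ) ≠ 0 ∧
      ∀ l : ℕ, (ProbabilityTheory.cond μ {ω | C ω = c}).real {ω | f ω = l} =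
        PYPSketch.thetaFactor θ m / J * (c.choose l : ℝ) *
          PYPSketch.rising (θ + α) (m - l) * PYPSketch.rising (1 - α) l *
          ((∑ i ∈ Finset.range (m - c + 1), ((m - c).choose i : ℝ) * (-1) ^ (m - c - i) *
              PYPSketch.distinctPGF (m - l - i) (1 / J) α (θ + α)) /
            (∑ i ∈ Finset.range (m - c + 1), ((m - c).choose i : ℝ) * (-1) ^ (m - c - i) *
              PYPSketch.distinctPGF (m - i + 1) (1 / J) α θ)) := by
  refine ⟨PYPSketch.measureReal_ncard_range_eq hα0 hα1 hθ hP hX, fun c hc => ?_⟩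
  have hJ' : (J : ℝ) ≠ 0 := by positivity
  -- A bucket count above m is impossible, so positivity of the conditioning event makes m - c a
  -- genuine difference.
  have hcm : c ≤ m := by
    by_contra hlt
    refine hc ?_
    convert measure_empty (μ := μ)
    ext ω
    have h1 := PYPSketch.bucketCount_add_one (h ω) fun i => X i ω
    have h2 := Finset.card_le_univ
      (Finset.univ.filter fun i => h ω (X i ω) = h ω (X (Fin.last m) ω))
    rw [Fintype.card_fin, ← h1, ← hC] at h2
    simp only [Set.mem_ofPred_eq, Set.mem_empty_iff_false, iff_false]
    omega
  have hmp : μ.real {ω | C ω = c} = J * (m.choose c *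
      ∑ i ∈ Finset.range (m - c + 1), ((m - c).choose i : ℝ) * (-1) ^ (m - c - i) *
        PYPSketch.distinctPGF (m - i + 1) (1 / J) α θ) := by
    have key := PYPSketch.measureReal_bucketCount_eq hα0 hα1 hθ hP hX hh hcm
    simp_rw [← hC] at key
    rw [key, mul_left_comm, Finset.mul_sum (a := (J : ℝ))]
    congr 1
    exact Finset.sum_congr rfl fun i _ => by ring
  have hc0 : μ.real {ω | C ω = c} ≠ 0 := by
    rw [measureReal_def]
    exact ENNReal.toReal_ne_zero.2 ⟨hc, measure_ne_top μ _⟩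
  set N := ∑ i ∈ Finset.range (m - c + 1), ((m - c).choose i : ℝ) * (-1) ^ (m - c - i) *
    PYPSketch.distinctPGF (m - i + 1) (1 / J) α θ with hN
  -- The conditioning event has probability J · C(m, c) · N, so its positivity is what makes the
  -- denominator nonzero.
  have hN0 : N ≠ 0 := fun h0 => hc0 (by rw [hmp, h0]; ring)
  refine ⟨hN0, fun l => ?_⟩
  have hCm : MeasurableSet {ω | C ω = c} := by
    have hmeas := PYPSketch.measurableSet_of_finset
      (Z := fun ω => Finset.univ.filter fun i => h ω (X i ω) = h ω (X (Fin.last m) ω))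
      (fun i => by simpa using PYPSketch.measurableSet_same_bucket hh i (Fin.last m))
      fun F => F.card = c + 1
    convert hmeas using 3 with ω
    rw [← PYPSketch.bucketCount_add_one (h ω) fun i => X i ω, ← hC, Nat.add_left_inj]
  have hcond : (ProbabilityTheory.cond μ {ω | C ω = c}).real {ω | f ω = l} =
      (μ.real {ω | C ω = c})⁻¹ * μ.real ({ω | C ω = c} ∩ {ω | f ω = l}) := by
    rw [measureReal_def, ProbabilityTheory.cond_apply hCm, ENNReal.toReal_mul, ENNReal.toReal_inv,
      measureReal_def, measureReal_def]
  rw [hcond]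
  -- For l > c both sides vanish, the right one through `c.choose l`, whatever the truncated indices
  -- are. For l ≤ c and i ≤ m - c the index m - l - i is a genuine difference.
  rcases lt_or_ge c l with hlc | hlc
  · have hempty : {ω | C ω = c} ∩ {ω | f ω = l} = ∅ := by
      ext ω
      simp only [Set.mem_inter_iff, Set.mem_ofPred_eq, Set.mem_empty_iff_false, iff_false]
      rintro ⟨h1, h2⟩
      classical
      have h3 := PYPSketch.bucketCount_add_one (h ω) fun i => X i ω
      have h4 := PYPSketch.freq_add_one fun i => X i ω
      have h5 : (Finset.univ.filter fun i => X i ω = X (Fin.last m) ω).card ≤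
          (Finset.univ.filter fun i => h ω (X i ω) = h ω (X (Fin.last m) ω)).card := by
        refine Finset.card_le_card fun i hi => ?_
        simp only [Finset.mem_filter, Finset.mem_univ, true_and] at hi ⊢
        rw [hi]
      rw [← h3, ← h4, ← hf, ← hC] at h5
      omega
    rw [hempty, measureReal_empty, Nat.choose_eq_zero_of_lt hlc]
    simp
  · have key := PYPSketch.measureReal_freq_bucketCount_eq hα0 hα1 hθ hJ hP hX hh hcm hlc
    simp_rw [← hC, ← hf] at key
    set M := ∑ i ∈ Finset.range (m - c + 1), ((m - c).choose i : ℝ) * (-1) ^ (m - c - i) *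
      PYPSketch.distinctPGF (m - l - i) (1 / J) α (θ + α) with hM
    have hsum : ∑ i ∈ Finset.range (m - c + 1), ((m - c).choose i : ℝ) * (-1) ^ (m - c - i) *
        (PYPSketch.rising (1 - α) l * PYPSketch.rising (θ + α) (m - l) /
          PYPSketch.rising (θ + 1) m * PYPSketch.distinctPGF (m - l - i) (1 / J) α (θ + α)) =
        PYPSketch.rising (1 - α) l * PYPSketch.rising (θ + α) (m - l) /
          PYPSketch.rising (θ + 1) m * M := by
      rw [hM, Finset.mul_sum]
      exact Finset.sum_congr rfl fun i _ => by ring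
    -- This trades the binomials of the joint law for C(m, c), which cancels against the marginal
    -- law, and leaves C(c, l).
    have hch : (m.choose c : ℝ) * c.choose l = m.choose l * (m - l).choose (c - l) := by
      exact_mod_cast Nat.choose_mul hlc
    have hch0 : (m.choose c : ℝ) ≠ 0 := by
      exact_mod_cast (Nat.choose_pos hcm).ne'
    have hr0 := (PYPSketch.rising_pos (show 0 < θ + 1 by linarith) m).ne'
    rw [key, hsum, hmp, PYPSketch.thetaFactor_eq, ← mul_assoc (m.choose l : ℝ), ← hch]
    field_simp
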